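/- $N$ objects appear in uniformly random order; at moment $n$ the $n$-th object appears, and its relative rank is its rank among the first $n$ objects. Let $u_N=0$, $u_n=\frac1{n+1}\max\{\frac{n+1}N,u_{n+1}\}+\frac n{n+1}u_{n+1}$ (the values of the classical secretary problem), and let $n^*$ be the smallest $n$ with $n/N\ge u_n$. Player 1 accepts the first object of relative rank 1 that appears at moment $n^*$ or later. Player 2 observes, in the same order, all objects except the one accepted by Player 1. He may accept one of them when it appears, and his payoff is 1 if it is the best of all $N$ objects and 0 otherwise. A candidate is an object that is the best of those seen so far by Player 2; the moments at which candidates appear are his decision points, and the decision of Player 2 whether to accept the current candidate is based on the list of his decision points so far. If a candidate appears at a moment $n>n^*$, then Player 1 has already accepted an object and the candidate has relative rank 1 or 2. Let $v(n,p)$ be the optimal expected payoff of Player 2 after he has rejected a candidate at moment $n>n^*$ which, given his history (the list of his decision points up to $n$), has relative rank 1 with probability $p$ and relative rank 2 with probability $1-p$; this is defined for every $p\in[0,1]$, and in the game itself $p$ is the posterior probability of relative rank 1 given the history. It depends on the history through $(n,p)$ only, and $v(n,0)$ is also the optimal future expected payoff of Player 2 when $n$ objects have appeared and Player 1 has accepted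 one of them, but Player 2 has not observed a candidate from moment $n^*$ to moment $n$. Let $v(n,-1)$ be the optimal future expected payoff of Player 2 when neither player has accepted any of the first $n$ objects. Theorem. For every $n$ with $n^*<n\le N$, the function $p\mapsto v(n,p)$ is non-decreasing on $[0,1]$. In addition, $v(n,-1)<v(n,0)$ for all $n$ with $n^*<n<N$. -/

import Mathlib

/-
The `N` objects appear in random order: `σ : Equiv.Perm (Fin N)` is uniformly distributed, the
object that appears at moment `i + 1` (`i : Fin N`) has absolute rank `σ i + 1`, so that smaller
values of `σ` are better and the best object is the one with `σ i = 0`.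
"The first `n` objects" are those with index `i < n`.
-/

/-- Player 1's optimal probability of selecting the best object when `m` objects are still to
appear, by dynamic programming: with `n = N - (m + 1)` objects already rejected it is
`(1 / (n + 1)) * max ((n + 1) / N) u + (n / (n + 1)) * u`, where `u` is the value with `n + 1`
objects rejected. -/
noncomputable def secretaryRem (N : ℕ) : ℕ → ℝ
  | 0 => 0
  | m + 1 =>
    (1 / (((N - (m + 1) : ℕ) : ℝ) + 1)) *
        max ((((N - (m + 1) : ℕ) : ℝ) + 1) / N) (secretaryRem N m) +
      (((N - (m + 1) : ℕ) : ℝ) / (((N - (m + 1) : ℕ) : ℝ) + 1)) * secretaryRem N m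

/-- `u_n`, `0 ≤ n ≤ N`: the optimal value of the classical secretary problem after the first `n`
objects have been rejected. -/
noncomputable def secretaryValue (N n : ℕ) : ℝ := secretaryRem N (N - n)

/-- `n*`: the smallest `n` with `u_n ≤ n / N`. -/
noncomputable def nStar (N : ℕ) : ℕ := sInf {n : ℕ | secretaryValue N n ≤ (n : ℝ) / N}

/-- The relative rank of the object with index `i`: its rank among the objects that have appeared
up to and including it. -/
noncomputable def relRank {N : ℕ} (σ : Equiv.Perm (Fin N)) (i : Fin N) : ℕ :=
  {j : Fin N | j ≤ i ∧ σ j ≤ σ i}.ncard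

/-- Player 1 obtains the object with index `i`: it is the first object of relative rank 1 that
appears at moment `n*` or later. -/
def PlayerOneAccepts {N : ℕ} (σ : Equiv.Perm (Fin N)) (i : Fin N) : Prop :=
  (nStar N ≤ i.val + 1 ∧ relRank σ i = 1) ∧
    ∀ j < i, ¬ (nStar N ≤ j.val + 1 ∧ relRank σ j = 1)

/-- The object with index `i` is a candidate according to Player 2: Player 2 sees it (Player 1 has
not taken it), and it is better than all the earlier objects that Player 2 has seen. -/
def IsCandidate {N : ℕ} (σ : Equiv.Perm (Fin N)) (i : Fin N) : Prop :=
  ¬ PlayerOneAccepts σ i ∧ ∀ j < i, ¬ PlayerOneAccepts σ j → σ i < σ j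

open Classical in
/-- The history of Player 2 up to index `i`: the set of his decision points so far, that is, of the
moments at which the candidates according to him have appeared. -/
noncomputable def history {N : ℕ} (σ : Equiv.Perm (Fin N)) (i : Fin N) : Finset (Fin N) :=
  {j : Fin N | j ≤ i ∧ IsCandidate σ j}

/-- The histories at which Player 2 accepts the current candidate. (At a decision point the current
moment is the largest element of the history.) -/
abbrev Strategy (N : ℕ) : Type := Set (Finset (Fin N))

/-- Player 2, who has not accepted any of the first `n` objects and uses the strategy `τ` from then
on, obtains the best of all the objects. -/
def Wins {N : ℕ} (τ : Strategy N) (n : ℕ) (σ : Equiv.Perm (Fin N)) : Prop :=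
  ∃ i : Fin N, n ≤ i.val ∧ IsCandidate σ i ∧ history σ i ∈ τ ∧
    (∀ j < i, n ≤ j.val → IsCandidate σ j → history σ j ∉ τ) ∧ (σ i).val = 0

/-- The conditional probability of `A` given `E` when all orders of the objects are equally
likely. -/
noncomputable def condProb {N : ℕ} (A E : Set (Equiv.Perm (Fin N))) : ℝ :=
  ((A ∩ E).ncard : ℝ) / (E.ncard : ℝ)

/-- The event that the object with index `i` is a candidate according to Player 2 and that his
history is then `h`. -/
def historyEvent {N : ℕ} (i : Fin N) (h : Finset (Fin N)) : Set (Equiv.Perm (Fin N)) :=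
  {σ | IsCandidate σ i ∧ history σ i = h}

/-- The part of `historyEvent i h` on which the current candidate has relative rank `r`. -/
def historyRankEvent {N : ℕ} (i : Fin N) (h : Finset (Fin N)) (r : ℕ) :
    Set (Equiv.Perm (Fin N)) :=
  {σ | σ ∈ historyEvent i h ∧ relRank σ i = r}

/-- The posterior probability, given the history `h`, that the current candidate (index `i`) has
relative rank 1. -/
noncomputable def posterior {N : ℕ} (i : Fin N) (h : Finset (Fin N)) : ℝ :=
  condProb {σ | relRank σ i = 1} (historyEvent i h)

/-- The optimal expected payoff of Player 2 after he has rejected the current candidate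
(index `i`), given the history `h`. -/
noncomputable def historyValue {N : ℕ} (i : Fin N) (h : Finset (Fin N)) : ℝ :=
  ⨆ τ : Strategy N, condProb {σ | Wins τ (i.val + 1) σ} (historyEvent i h)

/-- The same when the current candidate, given the history `h`, has relative rank 1 with an
arbitrary probability `p` and relative rank 2 with probability `1 - p`. -/
noncomputable def beliefValue {N : ℕ} (i : Fin N) (h : Finset (Fin N)) (p : ℝ) : ℝ :=
  ⨆ τ : Strategy N,
    (p * condProb {σ | Wins τ (i.val + 1) σ} (historyRankEvent i h 1) +
      (1 - p) * condProb {σ | Wins τ (i.val + 1) σ} (historyRankEvent i h 2))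

/-- `v(n, 0)`, `n ≥ n*`: the optimal future expected payoff of Player 2 given that Player 1 has
accepted one of the first `n` objects and that Player 2 has not observed a candidate from moment
`n*` to moment `n`. -/
noncomputable def valueZero (N n : ℕ) : ℝ :=
  ⨆ τ : Strategy N, condProb {σ | Wins τ n σ}
    {σ | (∃ i : Fin N, i.val < n ∧ PlayerOneAccepts σ i) ∧
      ∀ j : Fin N, nStar N ≤ j.val + 1 → j.val < n → ¬ IsCandidate σ j}

/-- `v(n, -1)`: the optimal future expected payoff of Player 2 given that neither player has
accepted any of the first `n` objects. -/
noncomputable def valueNegOne (N n : ℕ) : ℝ :=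
  ⨆ τ : Strategy N, condProb {σ | Wins τ n σ}
    {σ | ∀ i : Fin N, i.val < n → ¬ PlayerOneAccepts σ i}

/-! After Player 1 has accepted, only one fact hidden from Player 2 matters: whether the best object
so far is one that Player 2 has seen (`stateFirst`) or the one that Player 1 took (`stateSecond`).
The next relative rank is uniform and independent of the past (`ncard_inter_numBetter`). In
`stateFirst` only rank 1 gives a candidate; in `stateSecond` ranks 1 and 2 both do, and Player 2
cannot tell them apart. Rank 1 leads to `stateFirst`, while rank 2 stays in `stateSecond`. Counting
permutations turns this into recursions for the winning probability of a fixed strategy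
(`ncard_wins_stateFirst`, `ncard_wins_stateSecond`), and optimizing over strategies gives the
Bellman recursion `optimalValue` in the unnormalized belief masses `(a, b)`. An accepted candidate
wins with mass `(a + b) / N`.

Monotonicity comes from supporting functionals. At each belief there is a linear functional `α a + β
b` that touches the value there and lies below it elsewhere; `α` and `β` play the role of the
winning probabilities of an optimal strategy in the two states. It suffices that `β ≤ α`
(`exists_subgradient`). In the inductive step the only delicate inequality compares the functional
`(α₁, β₁)` for "no candidate" with `(α₂, β₂)` for "candidate rejected": if `α₁ < β₂`, then `β₁ ≤ α₁
< β₂ ≤ α₂`, and the second functional would beat the first at the very belief where the first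
attains the value.

For the strict inequality, the recursion at belief `(0, 1)` and monotonicity give `v(n,0) ≥
v(n+1,0)`, whereas `v(n,-1)` averages `v(n+1,-1)` and `v(n+1,0)`. Backward induction, started by the
positive payoff `1 / N` at the last object, finishes (`optimalValueNone_le_and_lt`). -/

/-- The first `n` objects are in the same relative order. -/
def SameOrder {N : ℕ} (n : ℕ) (σ σ' : Equiv.Perm (Fin N)) : Prop :=
  ∀ j k : Fin N, j.val < n → k.val < n → (σ j < σ k ↔ σ' j < σ' k)

/-- The event `E` only depends on the relative order of the first `n` objects. -/
def Determined {N : ℕ} (n : ℕ) (E : Set (Equiv.Perm (Fin N))) : Prop :=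
  ∀ σ σ', SameOrder n σ σ' → σ ∈ E → σ' ∈ E

/-- The number of objects before `i` that are better than `i`. -/
def numBetter {N : ℕ} (σ : Equiv.Perm (Fin N)) (i : Fin N) : ℕ :=
  (Finset.univ.filter fun j : Fin N => j < i ∧ σ j < σ i).card

/-! ### Quantities determined by the relative order of the first objects. -/

namespace SameOrder

variable {N n m : ℕ} {σ σ' σ'' : Equiv.Perm (Fin N)}

theorem refl (n : ℕ) (σ : Equiv.Perm (Fin N)) : SameOrder n σ σ := fun _ _ _ _ => Iff.rfl

theorem symm (h : SameOrder n σ σ') : SameOrder n σ' σ := fun j k hj hk => (h j k hj hk).symm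

theorem trans (h : SameOrder n σ σ') (h' : SameOrder n σ' σ'') : SameOrder n σ σ'' :=
  fun j k hj hk => (h j k hj hk).trans (h' j k hj hk)

theorem mono (h : SameOrder n σ σ') (hm : m ≤ n) : SameOrder m σ σ' :=
  fun j k hj hk => h j k (by omega) (by omega)

theorem le_iff (h : SameOrder n σ σ') {j k : Fin N} (hj : j.val < n) (hk : k.val < n) :
    σ j ≤ σ k ↔ σ' j ≤ σ' k := by
  rw [← not_lt, ← not_lt, h k j hk hj]

theorem numBetter_eq (h : SameOrder n σ σ') {i : Fin N} (hi : i.val < n) :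
    numBetter σ i = numBetter σ' i := by
  unfold numBetter
  congr 1
  ext j
  simp only [Finset.mem_filter, Finset.mem_univ, true_and]
  refine and_congr_right fun hj => h j i ?_ hi
  have : j.val < i.val := hj
  omega

theorem relRank_eq (h : SameOrder n σ σ') {i : Fin N} (hi : i.val < n) :
    relRank σ i = relRank σ' i := by
  unfold relRank
  congr 1
  ext j
  refine and_congr_right fun hj => h.le_iff ?_ hi
  have : j.val ≤ i.val := hj
  omega

theorem playerOneAccepts_iff (h : SameOrder n σ σ') {i : Fin N} (hi : i.val < n) :
    PlayerOneAccepts σ i ↔ PlayerOneAccepts σ' i := by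
  unfold PlayerOneAccepts
  rw [h.relRank_eq hi]
  refine and_congr_right fun _ => forall₂_congr fun j hj => ?_
  have : j.val < i.val := hj
  rw [h.relRank_eq (i := j) (by omega)]

theorem isCandidate_iff (h : SameOrder n σ σ') {i : Fin N} (hi : i.val < n) :
    IsCandidate σ i ↔ IsCandidate σ' i := by
  unfold IsCandidate
  rw [h.playerOneAccepts_iff hi]
  refine and_congr_right fun _ => forall₂_congr fun j hj => ?_
  have : j.val < i.val := hj
  rw [h.playerOneAccepts_iff (i := j) (by omega), h i j hi (by omega)]

end SameOrder

theorem Determined.mono {N n m : ℕ} {E : Set (Equiv.Perm (Fin N))} (h : Determined n E)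
    (hm : n ≤ m) : Determined m E := fun σ σ' hs => h σ σ' (hs.mono hm)

theorem Determined.inter {N n : ℕ} {E E' : Set (Equiv.Perm (Fin N))} (h : Determined n E)
    (h' : Determined n E') : Determined n (E ∩ E') :=
  fun σ σ' hs hE => ⟨h σ σ' hs hE.1, h' σ σ' hs hE.2⟩

theorem determined_numBetter {N : ℕ} (i : Fin N) (P : ℕ → Prop) :
    Determined (i.val + 1) {σ : Equiv.Perm (Fin N) | P (numBetter σ i)} := by
  intro σ σ' hs hE
  simp only [Set.mem_ofPred_eq] at hE ⊢
  rwa [← hs.numBetter_eq (Nat.lt_succ_self _)]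

theorem relRank_eq_numBetter_add_one {N : ℕ} (σ : Equiv.Perm (Fin N)) (i : Fin N) :
    relRank σ i = numBetter σ i + 1 := by
  have h : {j : Fin N | j ≤ i ∧ σ j ≤ σ i} =
      ((insert i (Finset.univ.filter fun j : Fin N => j < i ∧ σ j < σ i) : Finset (Fin N)) :
        Set (Fin N)) := by
    ext j
    simp only [Set.mem_ofPred_eq, Finset.coe_insert, Finset.coe_filter, Finset.mem_univ, true_and,
      Set.mem_insert_iff]
    constructor
    · rintro ⟨h1, h2⟩
      rcases eq_or_ne j i with h | h
      · exact Or.inl h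
      · exact Or.inr ⟨lt_of_le_of_ne h1 h, lt_of_le_of_ne h2 fun h' => h (σ.injective h')⟩
    · rintro (rfl | ⟨h1, h2⟩)
      · exact ⟨le_rfl, le_rfl⟩
      · exact ⟨h1.le, h2.le⟩
  unfold relRank numBetter
  rw [h, Set.ncard_coe_finset, Finset.card_insert_of_notMem (by simp)]

theorem numBetter_eq_zero_iff {N : ℕ} {σ : Equiv.Perm (Fin N)} {i : Fin N} :
    numBetter σ i = 0 ↔ ∀ j < i, σ i < σ j := by
  unfold numBetter
  rw [Finset.card_eq_zero, Finset.filter_eq_empty_iff]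
  constructor
  · intro h j hj
    have := h (Finset.mem_univ j)
    push Not at this
    exact lt_of_le_of_ne (this hj) fun h' => hj.ne' (σ.injective h')
  · rintro h j - ⟨hj, hlt⟩
    exact absurd hlt (h j hj).asymm

theorem numBetter_le {N : ℕ} (σ : Equiv.Perm (Fin N)) (i : Fin N) : numBetter σ i ≤ i.val := by
  calc numBetter σ i ≤ (Finset.Iio i).card := Finset.card_le_card fun j hj => by
        simp only [Finset.mem_filter] at hj
        exact Finset.mem_Iio.2 hj.2.1
    _ = i.val := by simp

/-- `k` is the object before `i` that comes directly after `i` in quality. -/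
def IsNextWorse {N : ℕ} (σ : Equiv.Perm (Fin N)) (i k : Fin N) : Prop :=
  k < i ∧ σ i < σ k ∧ ∀ j < i, σ i < σ j → σ k ≤ σ j

/-- `k` is the object before `i` that comes directly before `i` in quality. -/
def IsNextBetter {N : ℕ} (σ : Equiv.Perm (Fin N)) (i k : Fin N) : Prop :=
  k < i ∧ σ k < σ i ∧ ∀ j < i, σ j < σ i → σ j ≤ σ k

theorem IsNextWorse.unique {N : ℕ} {σ : Equiv.Perm (Fin N)} {i k l : Fin N}
    (hk : IsNextWorse σ i k) (hl : IsNextWorse σ i l) : k = l :=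
  σ.injective (le_antisymm (hk.2.2 l hl.1 hl.2.1) (hl.2.2 k hk.1 hk.2.1))

theorem IsNextBetter.unique {N : ℕ} {σ : Equiv.Perm (Fin N)} {i k l : Fin N}
    (hk : IsNextBetter σ i k) (hl : IsNextBetter σ i l) : k = l :=
  σ.injective (le_antisymm (hl.2.2 k hk.1 hk.2.1) (hk.2.2 l hl.1 hl.2.1))

/-! ### Exchanging an object with its neighbour in quality. -/

section SwapNeighbours

variable {N : ℕ} {σ : Equiv.Perm (Fin N)} {i k : Fin N}

theorem mul_swap_apply_of_lt {j : Fin N} (hj : j < i) (hjk : j ≠ k) :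
    (σ * Equiv.swap i k) j = σ j := by
  rw [Equiv.Perm.mul_apply, Equiv.swap_apply_of_ne_of_ne hj.ne hjk]

/-- No earlier object lies between `i` and `k` in quality, so giving `k` the rank of `i` changes no
comparison among the earlier objects. -/
theorem IsNextWorse.sameOrder (hk : IsNextWorse σ i k) :
    SameOrder i.val σ (σ * Equiv.swap i k) := by
  have key : ∀ j < i, j ≠ k → (σ j < σ k ↔ σ j < σ i) := by
    intro j hj hjk
    constructor
    · intro h
      by_contra hcon
      exact absurd (hk.2.2 j hj (lt_of_le_of_ne (not_lt.1 hcon) fun h' => hj.ne' (σ.injective h')))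
        (not_le.2 h)
    · exact fun h => h.trans hk.2.1
  have ek : (σ * Equiv.swap i k) k = σ i := by simp
  intro j l hj hl
  have hj' : j < i := hj
  have hl' : l < i := hl
  rcases eq_or_ne j k with rfl | hjk <;> rcases eq_or_ne l j with rfl | hlj
  · simp
  · rw [ek, mul_swap_apply_of_lt hl' hlj]
    have := key l hl' hlj
    have h1 : σ l ≠ σ j := fun h => hlj (σ.injective h)
    have h2 : σ l ≠ σ i := fun h => hl'.ne (σ.injective h)
    rw [← not_le, ← not_le, le_iff_lt_or_eq, le_iff_lt_or_eq]
    tauto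
  · simp
  · rcases eq_or_ne l k with rfl | hlk
    · rw [ek, mul_swap_apply_of_lt hj' hjk, key j hj' hjk]
    · rw [mul_swap_apply_of_lt hj' hjk, mul_swap_apply_of_lt hl' hlk]

theorem IsNextWorse.isNextBetter_mul_swap (hk : IsNextWorse σ i k) :
    IsNextBetter (σ * Equiv.swap i k) i k := by
  have ek : (σ * Equiv.swap i k) k = σ i := by simp
  have ei : (σ * Equiv.swap i k) i = σ k := by simp
  refine ⟨hk.1, by rw [ek, ei]; exact hk.2.1, fun j hj hlt => ?_⟩
  rcases eq_or_ne j k with rfl | hjk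
  · exact le_rfl
  · rw [ei, mul_swap_apply_of_lt hj hjk] at hlt
    rw [ek, mul_swap_apply_of_lt hj hjk]
    by_contra hcon
    exact absurd (hk.2.2 j hj (not_le.1 hcon)) (not_le.2 hlt)

theorem IsNextBetter.isNextWorse_mul_swap (hk : IsNextBetter σ i k) :
    IsNextWorse (σ * Equiv.swap i k) i k := by
  have ek : (σ * Equiv.swap i k) k = σ i := by simp
  have ei : (σ * Equiv.swap i k) i = σ k := by simp
  refine ⟨hk.1, by rw [ek, ei]; exact hk.2.1, fun j hj hlt => ?_⟩
  rcases eq_or_ne j k with rfl | hjk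
  · exact le_rfl
  · rw [ei, mul_swap_apply_of_lt hj hjk] at hlt
    rw [ek, mul_swap_apply_of_lt hj hjk]
    by_contra hcon
    exact absurd (hk.2.2 j hj (not_le.1 hcon)) (not_le.2 hlt)

theorem IsNextWorse.numBetter_mul_swap (hk : IsNextWorse σ i k) :
    numBetter (σ * Equiv.swap i k) i = numBetter σ i + 1 := by
  have ek : (σ * Equiv.swap i k) k = σ i := by simp
  have ei : (σ * Equiv.swap i k) i = σ k := by simp
  unfold numBetter
  rw [← Finset.card_insert_of_notMem (a := k)
    (s := Finset.univ.filter fun j : Fin N => j < i ∧ σ j < σ i)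
    (by simp [hk.2.1.le])]
  congr 1
  ext j
  simp only [Finset.mem_filter, Finset.mem_univ, true_and, Finset.mem_insert]
  rcases eq_or_ne j k with rfl | hjk
  · simp only [ek, ei, true_or, iff_true]
    exact ⟨hk.1, hk.2.1⟩
  · simp only [hjk, false_or]
    refine and_congr_right fun hj => ?_
    rw [mul_swap_apply_of_lt hj hjk, ei]
    constructor
    · intro h
      by_contra hcon
      exact absurd (hk.2.2 j hj (lt_of_le_of_ne (not_lt.1 hcon) fun h' => hj.ne' (σ.injective h')))
        (not_le.2 h)
    · exact fun h => h.trans hk.2.1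

theorem exists_isNextWorse (h : numBetter σ i < i.val) : ∃ k, IsNextWorse σ i k := by
  have hne : (Finset.univ.filter fun j : Fin N => j < i ∧ σ i < σ j).Nonempty := by
    by_contra hcon
    rw [Finset.not_nonempty_iff_eq_empty, Finset.filter_eq_empty_iff] at hcon
    have : (Finset.Iio i).card ≤ numBetter σ i := Finset.card_le_card fun j hj => by
      have hj' := Finset.mem_Iio.1 hj
      have := hcon (Finset.mem_univ j)
      push Not at this
      simp only [Finset.mem_filter, Finset.mem_univ, true_and]
      exact ⟨hj', lt_of_le_of_ne (this hj') fun h' => hj'.ne (σ.injective h')⟩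
    simp at this
    omega
  obtain ⟨k, hk, hmin⟩ := Finset.exists_min_image _ σ hne
  simp only [Finset.mem_filter, Finset.mem_univ, true_and] at hk hmin
  exact ⟨k, hk.1, hk.2, fun j hj hlt => hmin j ⟨hj, hlt⟩⟩

theorem exists_isNextBetter (h : 0 < numBetter σ i) : ∃ k, IsNextBetter σ i k := by
  obtain ⟨k, hk, hmax⟩ := Finset.exists_max_image _ σ (Finset.card_pos.1 h)
  simp only [Finset.mem_filter, Finset.mem_univ, true_and] at hk hmax
  exact ⟨k, hk.1, hk.2, fun j hj hlt => hmax j ⟨hj, hlt⟩⟩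

end SwapNeighbours

/-! ### Uniformity and independence of relative ranks. -/

section Counting

variable {N : ℕ} {E : Set (Equiv.Perm (Fin N))}

-- Exchanging `i` with its next worse predecessor is invertible, the inverse being the exchange with
-- the next better one. It stays inside `E` and raises `numBetter` by one.
open Classical in
theorem ncard_numBetter_succ {i : Fin N} (hE : Determined i.val E) {r : ℕ} (hr : r < i.val) :
    (E ∩ {σ | numBetter σ i = r}).ncard = (E ∩ {σ | numBetter σ i = r + 1}).ncard := by
  set R : Equiv.Perm (Fin N) → Equiv.Perm (Fin N) → Prop := fun σ ω =>
    ∃ k, IsNextWorse σ i k ∧ ω = σ * Equiv.swap i k with hR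
  have hRinv : ∀ σ ω, R σ ω → ∃ k, IsNextBetter ω i k ∧ σ = ω * Equiv.swap i k := by
    rintro σ ω ⟨k, hk, rfl⟩
    exact ⟨k, hk.isNextBetter_mul_swap, by rw [mul_assoc, Equiv.swap_mul_self, mul_one]⟩
  rw [Set.ncard_eq_toFinset_card', Set.ncard_eq_toFinset_card']
  apply le_antisymm
  · refine Finset.card_le_card_of_forall_subsingleton R ?_ ?_
    · intro σ hσ
      simp only [Set.mem_toFinset, Set.mem_inter_iff, Set.mem_ofPred_eq] at hσ
      obtain ⟨k, hk⟩ := exists_isNextWorse (hσ.2 ▸ hr)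
      refine ⟨σ * Equiv.swap i k, ?_, k, hk, rfl⟩
      simp only [Set.mem_toFinset, Set.mem_inter_iff, Set.mem_ofPred_eq]
      exact ⟨hE _ _ hk.sameOrder hσ.1, by rw [hk.numBetter_mul_swap, hσ.2]⟩
    · rintro ω - σ ⟨-, hσ⟩ σ' ⟨-, hσ'⟩
      obtain ⟨k, hk, rfl⟩ := hRinv _ _ hσ
      obtain ⟨l, hl, rfl⟩ := hRinv _ _ hσ'
      rw [hk.unique hl]
  · refine Finset.card_le_card_of_forall_subsingleton (fun ω σ => R σ ω) ?_ ?_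
    · intro ω hω
      simp only [Set.mem_toFinset, Set.mem_inter_iff, Set.mem_ofPred_eq] at hω
      obtain ⟨k, hk⟩ := exists_isNextBetter (σ := ω) (i := i) (by omega)
      have hw := hk.isNextWorse_mul_swap
      have he : ω = ω * Equiv.swap i k * Equiv.swap i k := by
        rw [mul_assoc, Equiv.swap_mul_self, mul_one]
      refine ⟨ω * Equiv.swap i k, ?_, k, hw, he⟩
      simp only [Set.mem_toFinset, Set.mem_inter_iff, Set.mem_ofPred_eq]
      have h1 := hw.sameOrder
      have h2 := hw.numBetter_mul_swap
      rw [← he] at h1 h2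
      exact ⟨hE _ _ h1.symm hω.1, by omega⟩
    · rintro σ - ω ⟨-, k, hk, rfl⟩ ω' ⟨-, l, hl, rfl⟩
      rw [hk.unique hl]

open Classical in
/-- The relative rank of `i` is uniformly distributed, independently of the relative order of the
earlier objects. -/
theorem ncard_inter_numBetter {i : Fin N} (hE : Determined i.val E) {r : ℕ} (hr : r ≤ i.val) :
    (((i.val : ℝ) + 1) * (E ∩ {σ | numBetter σ i = r}).ncard : ℝ) = E.ncard := by
  have hconst : ∀ s ≤ i.val, (E ∩ {σ | numBetter σ i = s}).ncard =
      (E ∩ {σ | numBetter σ i = 0}).ncard := by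
    intro s
    induction s with
    | zero => exact fun _ => rfl
    | succ s ih =>
      intro hs
      rw [← ncard_numBetter_succ hE (by omega), ih (by omega)]
  have hsum := Finset.card_eq_sum_card_fiberwise (f := fun σ => numBetter σ i) (s := E.toFinset)
    (t := Finset.range (i.val + 1)) (fun σ _ => by
      have := numBetter_le σ i
      simp; omega)
  have hfib : ∀ s ∈ Finset.range (i.val + 1),
      (E.toFinset.filter fun σ => numBetter σ i = s).card =
        (E ∩ {σ | numBetter σ i = r}).ncard := by
    intro s hs
    rw [hconst r hr, ← hconst s (by simp at hs; omega), Set.ncard_eq_toFinset_card']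
    congr 1
    ext σ
    simp
  rw [Finset.sum_congr rfl hfib, Finset.sum_const, Finset.card_range, smul_eq_mul,
    ← Set.ncard_eq_toFinset_card'] at hsum
  rw [hsum]
  push_cast
  ring

theorem ncard_inter_add_ncard_inter_compl {α : Type*} [Finite α] (E : Set α) (P : α → Prop) :
    ((E ∩ {x | P x}).ncard + (E ∩ {x | ¬ P x}).ncard : ℝ) = E.ncard := by
  have := Set.ncard_inter_add_ncard_sdiff_eq_ncard E {x | P x}
  rw [← this]
  push_cast
  rfl

theorem ncard_inter_numBetter_ne_zero {i : Fin N} (hE : Determined i.val E) :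
    (((i.val : ℝ) + 1) * (E ∩ {σ | numBetter σ i ≠ 0}).ncard : ℝ) = i.val * E.ncard := by
  have h1 := ncard_inter_numBetter hE (Nat.zero_le _)
  have h2 := ncard_inter_add_ncard_inter_compl E fun σ => numBetter σ i = 0
  simp only [ne_eq]
  linear_combination ((i.val : ℝ) + 1) * h2 - h1

theorem exists_sameOrder_numBetter_eq (σ : Equiv.Perm (Fin N)) (i : Fin N) {r : ℕ}
    (hr : r ≤ i.val) : ∃ σ', SameOrder i.val σ σ' ∧ numBetter σ' i = r := by
  have hE : Determined i.val {σ' | SameOrder i.val σ σ'} := fun _ _ h h' => SameOrder.trans h' h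
  have h1 := ncard_inter_numBetter hE hr
  have h2 : 0 < {σ' | SameOrder i.val σ σ'}.ncard :=
    (Set.ncard_pos).2 ⟨σ, SameOrder.refl _ _⟩
  by_contra hcon
  push Not at hcon
  have h3 : {σ' | SameOrder i.val σ σ'} ∩ {σ' | numBetter σ' i = r} = ∅ := by
    ext σ'
    simpa using hcon σ'
  rw [h3] at h1
  simp only [Set.ncard_empty, Nat.cast_zero, mul_zero] at h1
  have : (0 : ℝ) < ({σ' | SameOrder i.val σ σ'}.ncard : ℝ) := by exact_mod_cast h2
  linarith

/-- The best of the first `m` objects is the best of all with probability `m / N`. -/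
theorem ncard_inter_best {m : ℕ} (hm : m ≤ N) : ∀ {E : Set (Equiv.Perm (Fin N))} {i : Fin N},
    Determined m E → i.val < m → (∀ σ ∈ E, ∀ j : Fin N, j.val < m → σ i ≤ σ j) →
    (N * (E ∩ {σ | (σ i).val = 0}).ncard : ℝ) = m * E.ncard := by
  induction hm using Nat.decreasingInduction with
  | self =>
    intro E i _ _ hbest
    have : E ∩ {σ | (σ i).val = 0} = E := by
      refine Set.inter_eq_left.2 fun σ hσ => ?_
      have hpos : 0 < N := i.pos
      have := hbest σ hσ (σ.symm ⟨0, hpos⟩) (Fin.is_lt _)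
      rw [Equiv.apply_symm_apply] at this
      exact Nat.le_zero.1 this
    rw [this]
  | of_succ m hm ih =>
    intro E i hE hi hbest
    have hcount := ncard_inter_numBetter_ne_zero (i := ⟨m, hm⟩) hE
    -- `i` can be best overall only if the object with index `m` does not beat it. Such orders form
    -- a share `m / (m + 1)` of `E`, and on them `i` is best of the first `m + 1`.
    have h1 := ih (E := E ∩ {σ | numBetter σ ⟨m, hm⟩ ≠ 0}) (i := i)
      ((hE.mono (Nat.le_succ m)).inter (determined_numBetter ⟨m, hm⟩ (· ≠ 0))) (by omega) (by
        rintro σ ⟨hσ, hne⟩ j hj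
        rcases Nat.lt_succ_iff_lt_or_eq.1 hj with hj | hj
        · exact hbest σ hσ j hj
        · have hjm : j = ⟨m, hm⟩ := Fin.ext hj
          subst hjm
          simp only [Set.mem_ofPred_eq, ne_eq, numBetter_eq_zero_iff] at hne
          push Not at hne
          obtain ⟨k, hk, hle⟩ := hne
          exact (hbest σ hσ k hk).trans hle)
    have h2 : E ∩ {σ | numBetter σ ⟨m, hm⟩ ≠ 0} ∩ {σ | (σ i).val = 0} =
        E ∩ {σ | (σ i).val = 0} := by
      ext σ
      simp only [Set.mem_inter_iff, Set.mem_ofPred_eq]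
      refine ⟨fun h => ⟨h.1.1, h.2⟩, fun h => ⟨⟨h.1, fun h0 => ?_⟩, h.2⟩⟩
      have : (σ ⟨m, hm⟩).val < (σ i).val := numBetter_eq_zero_iff.1 h0 i hi
      omega
    rw [h2] at h1
    simp only at hcount
    rw [h1]
    push_cast
    exact hcount

end Counting

/-! ### The hidden states and their transitions. -/

open Classical in
/-- The moments before `n` at which candidates according to Player 2 have appeared. -/
noncomputable def candidatesBefore {N : ℕ} (σ : Equiv.Perm (Fin N)) (n : ℕ) : Finset (Fin N) :=
  {j : Fin N | j.val < n ∧ IsCandidate σ j}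

/-- Player 1 has not accepted any of the first `n` objects, and Player 2's candidates form `h`. -/
def stateNone {N : ℕ} (n : ℕ) (h : Finset (Fin N)) : Set (Equiv.Perm (Fin N)) :=
  {σ | candidatesBefore σ n = h ∧ ∀ i : Fin N, i.val < n → ¬ PlayerOneAccepts σ i}

/-- Player 1 has accepted one of the first `n` objects, but not the best of them, and Player 2's
candidates form `h`. -/
def stateFirst {N : ℕ} (n : ℕ) (h : Finset (Fin N)) : Set (Equiv.Perm (Fin N)) :=
  {σ | candidatesBefore σ n = h ∧
    ∃ a : Fin N, a.val < n ∧ PlayerOneAccepts σ a ∧ ∃ j : Fin N, j.val < n ∧ σ j < σ a}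

/-- Player 1 has accepted the best of the first `n` objects, and Player 2's candidates form `h`. -/
def stateSecond {N : ℕ} (n : ℕ) (h : Finset (Fin N)) : Set (Equiv.Perm (Fin N)) :=
  {σ | candidatesBefore σ n = h ∧
    ∃ a : Fin N, a.val < n ∧ PlayerOneAccepts σ a ∧ ∀ j : Fin N, j.val < n → σ a ≤ σ j}

section States

variable {N n : ℕ} {σ : Equiv.Perm (Fin N)} {h : Finset (Fin N)} {i : Fin N}

theorem PlayerOneAccepts.unique {a b : Fin N} (ha : PlayerOneAccepts σ a)
    (hb : PlayerOneAccepts σ b) : a = b := by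
  rcases lt_trichotomy a b with h | h | h
  · exact absurd ha.1 (hb.2 a h)
  · exact h
  · exact absurd hb.1 (ha.2 b h)

theorem PlayerOneAccepts.le {a j : Fin N} (ha : PlayerOneAccepts σ a) (hj : j ≤ a) :
    σ a ≤ σ j := by
  rcases hj.eq_or_lt with rfl | hj
  · exact le_rfl
  · have := ha.1.2
    rw [relRank_eq_numBetter_add_one, Nat.add_eq_right, numBetter_eq_zero_iff] at this
    exact (this j hj).le

theorem mem_candidatesBefore {j : Fin N} :
    j ∈ candidatesBefore σ n ↔ j.val < n ∧ IsCandidate σ j := by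
  simp [candidatesBefore]

theorem history_eq_candidatesBefore (σ : Equiv.Perm (Fin N)) (i : Fin N) :
    history σ i = candidatesBefore σ (i.val + 1) := by
  ext j
  simp only [history, candidatesBefore, Finset.mem_filter, Finset.mem_univ, true_and]
  rw [Nat.lt_succ_iff, Fin.le_def]

theorem SameOrder.candidatesBefore_eq {σ' : Equiv.Perm (Fin N)} (hs : SameOrder n σ σ') :
    candidatesBefore σ n = candidatesBefore σ' n := by
  ext j
  rw [mem_candidatesBefore, mem_candidatesBefore]
  exact and_congr_right fun hj => hs.isCandidate_iff hj

theorem candidatesBefore_succ_of_isCandidate (hc : IsCandidate σ i) :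
    candidatesBefore σ (i.val + 1) = insert i (candidatesBefore σ i.val) := by
  ext j
  rw [Finset.mem_insert, mem_candidatesBefore, mem_candidatesBefore, Nat.lt_succ_iff_lt_or_eq,
    ← Fin.ext_iff]
  constructor
  · rintro ⟨h1 | h1, h2⟩
    · exact Or.inr ⟨h1, h2⟩
    · exact Or.inl h1
  · rintro (rfl | ⟨h1, h2⟩)
    · exact ⟨Or.inr rfl, hc⟩
    · exact ⟨Or.inl h1, h2⟩

theorem candidatesBefore_succ_of_not_isCandidate (hc : ¬ IsCandidate σ i) :
    candidatesBefore σ (i.val + 1) = candidatesBefore σ i.val := by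
  ext j
  rw [mem_candidatesBefore, mem_candidatesBefore, Nat.lt_succ_iff_lt_or_eq, ← Fin.ext_iff]
  constructor
  · rintro ⟨h1 | rfl, h2⟩
    · exact ⟨h1, h2⟩
    · exact absurd h2 hc
  · exact fun h => ⟨Or.inl h.1, h.2⟩

theorem determined_stateSecond (n : ℕ) (h : Finset (Fin N)) :
    Determined n (stateSecond n h) := by
  rintro σ σ' hs ⟨h1, a, ha, hp, hle⟩
  exact ⟨hs.candidatesBefore_eq ▸ h1, a, ha, (hs.playerOneAccepts_iff ha).1 hp, fun j hj =>
    (hs.le_iff ha hj).1 (hle j hj)⟩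

theorem not_playerOneAccepts_of_lt {a : Fin N} (ha : PlayerOneAccepts σ a) (hai : a < i) :
    ¬ PlayerOneAccepts σ i := fun hi => hai.ne (ha.unique hi)

theorem isCandidate_of_numBetter_eq_zero {a : Fin N} (ha : PlayerOneAccepts σ a) (hai : a < i)
    (h0 : numBetter σ i = 0) : IsCandidate σ i :=
  ⟨not_playerOneAccepts_of_lt ha hai, fun j hj _ => numBetter_eq_zero_iff.1 h0 j hj⟩

/-- The only better predecessor is Player 1's object, which Player 2 has not seen. -/
theorem isCandidate_of_numBetter_eq_one {a : Fin N} (ha : PlayerOneAccepts σ a) (hai : a < i)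
    (hlt : σ a < σ i) (h1 : numBetter σ i = 1) : IsCandidate σ i := by
  refine ⟨not_playerOneAccepts_of_lt ha hai, fun j hj hpj => ?_⟩
  by_contra hcon
  have hlt' : σ j < σ i := lt_of_le_of_ne (not_lt.1 hcon) fun h' => hj.ne (σ.injective h')
  have := Finset.card_le_one.1 h1.le j (by simp [hj, hlt']) a (by simp [hai, hlt])
  exact hpj (this ▸ ha)

theorem not_isCandidate_of_lt {j : Fin N} (hj : j < i) (hlt : σ j < σ i)
    (hp : ¬ PlayerOneAccepts σ j) : ¬ IsCandidate σ i := fun hc => (hc.2 j hj hp).asymm hlt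

theorem exists_ne_of_one_lt_numBetter (a : Fin N) (h1 : 1 < numBetter σ i) :
    ∃ j < i, σ j < σ i ∧ j ≠ a := by
  obtain ⟨j, hj, hja⟩ := Finset.exists_mem_ne h1 a
  simp only [Finset.mem_filter, Finset.mem_univ, true_and] at hj
  exact ⟨j, hj.1, hj.2, hja⟩

theorem exists_of_numBetter_ne_zero (h0 : numBetter σ i ≠ 0) : ∃ j < i, σ j < σ i := by
  rw [ne_eq, numBetter_eq_zero_iff] at h0
  push Not at h0
  obtain ⟨j, hj, hle⟩ := h0
  exact ⟨j, hj, lt_of_le_of_ne hle fun h' => hj.ne (σ.injective h')⟩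

/-- If Player 1 has accepted an object that is not the best so far, only a new best object is a
candidate. -/
theorem not_isCandidate_of_mem_stateFirst (hσ : σ ∈ stateFirst i.val h)
    (h0 : numBetter σ i ≠ 0) : ¬ IsCandidate σ i := by
  obtain ⟨-, a, ha, hp, j, hj, hlt⟩ := hσ
  obtain ⟨k, hk, hki⟩ := exists_of_numBetter_ne_zero h0
  by_cases hka : k = a
  · subst hka
    exact not_isCandidate_of_lt hj (hlt.trans hki) fun hpj => hlt.ne (congrArg σ (hpj.unique hp))
  · exact not_isCandidate_of_lt hk hki fun hpk => hka (hpk.unique hp)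

theorem stateFirst_succ_of_numBetter_ne_zero (hσ : σ ∈ stateFirst i.val h)
    (h0 : numBetter σ i ≠ 0) : σ ∈ stateFirst (i.val + 1) h := by
  refine ⟨?_, ?_⟩
  · rw [candidatesBefore_succ_of_not_isCandidate (not_isCandidate_of_mem_stateFirst hσ h0), hσ.1]
  · obtain ⟨-, a, ha, hp, j, hj, hlt⟩ := hσ
    exact ⟨a, by omega, hp, j, by omega, hlt⟩

theorem stateFirst_succ_of_numBetter_eq_zero {a : Fin N} (ha : PlayerOneAccepts σ a)
    (hai : a < i) (hh : candidatesBefore σ i.val = h) (h0 : numBetter σ i = 0) :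
    IsCandidate σ i ∧ σ ∈ stateFirst (i.val + 1) (insert i h) := by
  have hc := isCandidate_of_numBetter_eq_zero ha hai h0
  refine ⟨hc, ?_, a, ?_, ha, i, Nat.lt_succ_self _, numBetter_eq_zero_iff.1 h0 a hai⟩
  · rw [candidatesBefore_succ_of_isCandidate hc, hh]
  · exact Nat.lt_succ_of_lt hai

theorem le_of_mem_stateSecond_of_numBetter_ne_zero {a : Fin N}
    (hle : ∀ j : Fin N, j.val < i.val → σ a ≤ σ j) (h0 : numBetter σ i ≠ 0) (j : Fin N)
    (hj : j.val < i.val + 1) : σ a ≤ σ j := by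
  rcases Nat.lt_succ_iff_lt_or_eq.1 hj with hj | hj
  · exact hle j hj
  · obtain ⟨k, hk, hki⟩ := exists_of_numBetter_ne_zero h0
    rw [Fin.ext hj]
    exact (hle k hk).trans hki.le

theorem stateSecond_succ_of_numBetter_eq_one (hσ : σ ∈ stateSecond i.val h)
    (h1 : numBetter σ i = 1) :
    IsCandidate σ i ∧ σ ∈ stateSecond (i.val + 1) (insert i h) ∧ (σ i).val ≠ 0 := by
  obtain ⟨hh, a, ha, hp, hle⟩ := hσ
  have hle' := le_of_mem_stateSecond_of_numBetter_ne_zero hle (by omega)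
  have hlt : σ a < σ i :=
    lt_of_le_of_ne (hle' i (Nat.lt_succ_self _)) fun h' => by
      have := σ.injective h'
      subst this
      exact lt_irrefl _ ha
  have hc := isCandidate_of_numBetter_eq_one hp ha hlt h1
  refine ⟨hc, ⟨?_, a, by omega, hp, hle'⟩, ?_⟩
  · rw [candidatesBefore_succ_of_isCandidate hc, hh]
  · have : (σ a).val < (σ i).val := hlt
    omega

/-- Of two better predecessors at least one is not Player 1's, so Player 2 has seen it. -/
theorem stateSecond_succ_of_one_lt_numBetter (hσ : σ ∈ stateSecond i.val h)
    (h1 : 1 < numBetter σ i) : ¬ IsCandidate σ i ∧ σ ∈ stateSecond (i.val + 1) h := by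
  obtain ⟨hh, a, ha, hp, hle⟩ := hσ
  obtain ⟨j, hj, hlt, hja⟩ := exists_ne_of_one_lt_numBetter a h1
  have hc := not_isCandidate_of_lt hj hlt fun hpj => hja (hpj.unique hp)
  refine ⟨hc, ?_, a, by omega, hp, le_of_mem_stateSecond_of_numBetter_ne_zero hle (by omega)⟩
  rw [candidatesBefore_succ_of_not_isCandidate hc, hh]

theorem stateNone_succ_of_numBetter_eq_zero (hn : nStar N ≤ i.val + 1)
    (hσ : σ ∈ stateNone i.val h) (h0 : numBetter σ i = 0) :
    ¬ IsCandidate σ i ∧ σ ∈ stateSecond (i.val + 1) h := by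
  have hrel : relRank σ i = 1 := by rw [relRank_eq_numBetter_add_one, h0]
  -- A qualifying earlier object would imply a first qualifying one, which Player 1 would have
  -- accepted.
  have hfirst : ∀ j < i, ¬ (nStar N ≤ j.val + 1 ∧ relRank σ j = 1) := by
    intro j
    induction j using WellFoundedLT.induction with
    | ind j ih =>
      intro hj hcon
      exact hσ.2 j hj ⟨hcon, fun k hk => ih k hk (hk.trans hj)⟩
  have hp : PlayerOneAccepts σ i := ⟨⟨hn, hrel⟩, hfirst⟩
  have hc : ¬ IsCandidate σ i := fun hc => hc.1 hp
  refine ⟨hc, ?_, i, Nat.lt_succ_self _, hp, fun j hj => hp.le (Nat.lt_succ_iff.1 hj)⟩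
  rw [candidatesBefore_succ_of_not_isCandidate hc, hσ.1]

/-- While Player 1 has taken nothing, Player 2 has seen every object, so one that is not best so far
interests neither player. -/
theorem stateNone_succ_of_numBetter_ne_zero (hσ : σ ∈ stateNone i.val h)
    (h0 : numBetter σ i ≠ 0) : ¬ IsCandidate σ i ∧ σ ∈ stateNone (i.val + 1) h := by
  obtain ⟨j, hj, hlt⟩ := exists_of_numBetter_ne_zero h0
  have hc := not_isCandidate_of_lt hj hlt (hσ.2 j hj)
  refine ⟨hc, ?_, fun k hk hp => ?_⟩
  · rw [candidatesBefore_succ_of_not_isCandidate hc, hσ.1]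
  · rcases Nat.lt_succ_iff_lt_or_eq.1 hk with hk | hk
    · exact hσ.2 k hk hp
    · rw [Fin.ext hk] at hp
      exact hlt.not_ge (hp.le hj.le)

theorem wins_iff_of_not_isCandidate {τ : Strategy N} (hc : ¬ IsCandidate σ i) :
    Wins τ i.val σ ↔ Wins τ (i.val + 1) σ := by
  constructor
  · rintro ⟨k, hk, hck, hτ, hj, hbest⟩
    have : k ≠ i := fun h => hc (h ▸ hck)
    exact ⟨k, lt_of_le_of_ne hk fun h => this (Fin.ext h.symm), hck, hτ,
      fun j hjk hj' => hj j hjk (by omega), hbest⟩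
  · rintro ⟨k, hk, hck, hτ, hj, hbest⟩
    refine ⟨k, by omega, hck, hτ, fun j hjk hij hcj => hj j hjk ?_ hcj, hbest⟩
    exact lt_of_le_of_ne hij fun h => hc ((Fin.ext h : i = j) ▸ hcj)

theorem wins_iff_of_notMem {τ : Strategy N} (hτ : history σ i ∉ τ) :
    Wins τ i.val σ ↔ Wins τ (i.val + 1) σ := by
  constructor
  · rintro ⟨k, hk, hck, hkτ, hj, hbest⟩
    have : k ≠ i := fun h => hτ (h ▸ hkτ)
    exact ⟨k, lt_of_le_of_ne hk fun h => this (Fin.ext h.symm), hck, hkτ,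
      fun j hjk hj' => hj j hjk (by omega), hbest⟩
  · rintro ⟨k, hk, hck, hkτ, hj, hbest⟩
    refine ⟨k, by omega, hck, hkτ, fun j hjk hij hcj => ?_, hbest⟩
    rcases hij.eq_or_lt with h | h
    · rwa [← (Fin.ext h : i = j)]
    · exact hj j hjk h hcj

theorem wins_iff_of_mem {τ : Strategy N} (hc : IsCandidate σ i) (hτ : history σ i ∈ τ) :
    Wins τ i.val σ ↔ (σ i).val = 0 := by
  constructor
  · rintro ⟨k, hk, hck, hkτ, hj, hbest⟩
    rcases hk.eq_or_lt with h | h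
    · rwa [(Fin.ext h : i = k)]
    · exact absurd hτ (hj i h le_rfl hc)
  · exact fun hbest => ⟨i, le_rfl, hc, hτ, fun j hj hij => absurd hj (not_lt.2 hij), hbest⟩

end States

/-! ### Winning probabilities of a fixed strategy. -/

open Classical in
/-- Player 2's probability of winning with `τ` from a state in `stateFirst n h`. -/
noncomputable def winFirst {N : ℕ} (τ : Strategy N) (n : ℕ) (h : Finset (Fin N)) : ℝ :=
  if hn : n < N then
    n / (n + 1) * winFirst τ (n + 1) h +
      1 / (n + 1) * (if insert ⟨n, hn⟩ h ∈ τ then ((n : ℝ) + 1) / N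
        else winFirst τ (n + 1) (insert ⟨n, hn⟩ h))
  else 0
termination_by N - n

open Classical in
/-- Player 2's probability of winning with `τ` from a state in `stateSecond n h`. -/
noncomputable def winSecond {N : ℕ} (τ : Strategy N) (n : ℕ) (h : Finset (Fin N)) : ℝ :=
  if hn : n < N then
    (n - 1) / (n + 1) * winSecond τ (n + 1) h +
      1 / (n + 1) * (if insert ⟨n, hn⟩ h ∈ τ then ((n : ℝ) + 1) / N
        else winFirst τ (n + 1) (insert ⟨n, hn⟩ h)) +
      1 / (n + 1) * (if insert ⟨n, hn⟩ h ∈ τ then 0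
        else winSecond τ (n + 1) (insert ⟨n, hn⟩ h))
  else 0
termination_by N - n

/-- Player 2's probability of winning with `τ` from a state in `stateNone n h`. -/
noncomputable def winNone {N : ℕ} (τ : Strategy N) (n : ℕ) (h : Finset (Fin N)) : ℝ :=
  if n < N then
    n / (n + 1) * winNone τ (n + 1) h + 1 / (n + 1) * winSecond τ (n + 1) h
  else 0
termination_by N - n

section WinProbabilities

variable {N n : ℕ} {τ : Strategy N} {h : Finset (Fin N)} {E : Set (Equiv.Perm (Fin N))}

theorem winFirst_self (τ : Strategy N) (h : Finset (Fin N)) : winFirst τ N h = 0 := by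
  rw [winFirst, dif_neg (lt_irrefl N)]

theorem winSecond_self (τ : Strategy N) (h : Finset (Fin N)) : winSecond τ N h = 0 := by
  rw [winSecond, dif_neg (lt_irrefl N)]

theorem winNone_self (τ : Strategy N) (h : Finset (Fin N)) : winNone τ N h = 0 := by
  rw [winNone, if_neg (lt_irrefl N)]

open Classical in
theorem winFirst_of_lt (τ : Strategy N) (hn : n < N) (h : Finset (Fin N)) :
    winFirst τ n h = n / (n + 1) * winFirst τ (n + 1) h +
      1 / (n + 1) * (if insert ⟨n, hn⟩ h ∈ τ then ((n : ℝ) + 1) / N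
        else winFirst τ (n + 1) (insert ⟨n, hn⟩ h)) := by
  rw [winFirst, dif_pos hn]

open Classical in
theorem winSecond_of_lt (τ : Strategy N) (hn : n < N) (h : Finset (Fin N)) :
    winSecond τ n h = (n - 1) / (n + 1) * winSecond τ (n + 1) h +
      1 / (n + 1) * (if insert ⟨n, hn⟩ h ∈ τ then ((n : ℝ) + 1) / N
        else winFirst τ (n + 1) (insert ⟨n, hn⟩ h)) +
      1 / (n + 1) * (if insert ⟨n, hn⟩ h ∈ τ then 0
        else winSecond τ (n + 1) (insert ⟨n, hn⟩ h)) := by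
  rw [winSecond, dif_pos hn]

theorem not_wins_self (τ : Strategy N) (σ : Equiv.Perm (Fin N)) : ¬ Wins τ N σ := by
  rintro ⟨i, hi, -⟩
  omega

theorem wins_inter_self (τ : Strategy N) (E : Set (Equiv.Perm (Fin N))) :
    {σ | Wins τ N σ} ∩ E = ∅ := by
  ext σ
  simp [not_wins_self]

theorem wins_inter_of_not_isCandidate {i : Fin N} (hc : ∀ σ ∈ E, ¬ IsCandidate σ i) :
    {σ | Wins τ i.val σ} ∩ E = {σ | Wins τ (i.val + 1) σ} ∩ E := by
  ext σ
  exact and_congr_left fun hσ => wins_iff_of_not_isCandidate (hc σ hσ)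

theorem wins_inter_of_notMem {i : Fin N}
    (hc : ∀ σ ∈ E, candidatesBefore σ (i.val + 1) = h) (hτ : h ∉ τ) :
    {σ | Wins τ i.val σ} ∩ E = {σ | Wins τ (i.val + 1) σ} ∩ E := by
  ext σ
  refine and_congr_left fun hσ => wins_iff_of_notMem ?_
  rwa [history_eq_candidatesBefore, hc σ hσ]

theorem wins_inter_of_mem {i : Fin N} (hi : ∀ σ ∈ E, IsCandidate σ i)
    (hc : ∀ σ ∈ E, candidatesBefore σ (i.val + 1) = h) (hτ : h ∈ τ) :
    {σ | Wins τ i.val σ} ∩ E = E ∩ {σ | (σ i).val = 0} := by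
  ext σ
  rw [Set.inter_comm]
  refine and_congr_right fun hσ => wins_iff_of_mem (hi σ hσ) ?_
  rwa [history_eq_candidatesBefore, hc σ hσ]

/-- The step common to `stateFirst` and `stateSecond`: on a new best object, acceptance wins with
probability `(i + 1) / N` and rejection leads to `stateFirst`. -/
theorem ncard_wins_of_numBetter_eq_zero {i : Fin N} {x : ℝ}
    (hE : Determined (i.val + 1) E) (h0 : ∀ σ ∈ E, numBetter σ i = 0)
    (hc : ∀ σ ∈ E, IsCandidate σ i ∧ σ ∈ stateFirst (i.val + 1) h)
    (hx : h ∈ τ → x = ((i.val : ℝ) + 1) / N)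
    (hx' : h ∉ τ → (({σ | Wins τ (i.val + 1) σ} ∩ E).ncard : ℝ) = x * E.ncard) :
    (({σ | Wins τ i.val σ} ∩ E).ncard : ℝ) = x * E.ncard := by
  by_cases hτ : h ∈ τ
  · rw [wins_inter_of_mem (fun σ hσ => (hc σ hσ).1) (fun σ hσ => (hc σ hσ).2.1) hτ, hx hτ]
    have := ncard_inter_best i.isLt hE (Nat.lt_succ_self _) (fun σ hσ j hj => by
      rcases Nat.lt_succ_iff_lt_or_eq.1 hj with hj | hj
      · exact (numBetter_eq_zero_iff.1 (h0 σ hσ) j hj).le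
      · rw [Fin.ext hj])
    have hN : (N : ℝ) ≠ 0 := by
      have := i.pos
      positivity
    push_cast at this
    field_simp
    linarith
  · rw [wins_inter_of_notMem (fun σ hσ => (hc σ hσ).2.1) hτ, hx' hτ]

theorem ncard_inter_split (W E : Set (Equiv.Perm (Fin N))) (P : Equiv.Perm (Fin N) → Prop) :
    ((W ∩ E).ncard : ℝ) = (W ∩ (E ∩ {σ | P σ})).ncard + (W ∩ (E ∩ {σ | ¬ P σ})).ncard := by
  rw [← Set.inter_assoc, ← Set.inter_assoc, ncard_inter_add_ncard_inter_compl]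

-- The claim is made for every determined part `E` of the state because conditioning on the next
-- relative rank cuts `E` further.
open Classical in
theorem ncard_wins_stateFirst (τ : Strategy N) (hn : n ≤ N) :
    ∀ {h : Finset (Fin N)} {E : Set (Equiv.Perm (Fin N))}, Determined n E →
      E ⊆ stateFirst n h → (({σ | Wins τ n σ} ∩ E).ncard : ℝ) = winFirst τ n h * E.ncard := by
  induction hn using Nat.decreasingInduction with
  | self =>
    intro h E _ _
    rw [wins_inter_self, winFirst_self]
    simp
  | of_succ n hn ih =>
    intro h E hE hsub
    set i : Fin N := ⟨n, hn⟩ with hi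
    have c0 : ((n : ℝ) + 1) * (E ∩ {σ | numBetter σ i = 0}).ncard = E.ncard :=
      ncard_inter_numBetter (i := i) hE (Nat.zero_le _)
    have c1 : ((n : ℝ) + 1) * (E ∩ {σ | ¬ numBetter σ i = 0}).ncard = n * E.ncard :=
      ncard_inter_numBetter_ne_zero (i := i) hE
    have hE' := hE.mono (Nat.le_succ n)
    have w0 := ncard_wins_of_numBetter_eq_zero (i := i) (τ := τ) (h := insert i h)
      (E := E ∩ {σ | numBetter σ i = 0})
      (x := if insert i h ∈ τ then ((n : ℝ) + 1) / N else winFirst τ (n + 1) (insert i h))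
      (hE'.inter (determined_numBetter i (· = 0))) (fun σ hσ => hσ.2)
      (by
        rintro σ ⟨hσ, h0⟩
        obtain ⟨hh, a, ha, hp, -⟩ := hsub hσ
        exact stateFirst_succ_of_numBetter_eq_zero hp ha hh h0)
      (fun hτ => if_pos hτ)
      (fun hτ => by
        rw [if_neg hτ]
        refine ih (hE'.inter (determined_numBetter i (· = 0))) ?_
        rintro σ ⟨hσ, h0⟩
        obtain ⟨hh, a, ha, hp, -⟩ := hsub hσ
        exact (stateFirst_succ_of_numBetter_eq_zero (i := i) hp ha hh h0).2)
    have w1 : (({σ | Wins τ n σ} ∩ (E ∩ {σ | ¬ numBetter σ i = 0})).ncard : ℝ) =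
        winFirst τ (n + 1) h * (E ∩ {σ | ¬ numBetter σ i = 0}).ncard := by
      rw [← ih (hE'.inter (determined_numBetter i (¬ · = 0)))]
      · exact congrArg (fun s : Set _ => (s.ncard : ℝ))
          (wins_inter_of_not_isCandidate (i := i) fun σ hσ =>
            not_isCandidate_of_mem_stateFirst (hsub hσ.1) hσ.2)
      · exact fun σ hσ => stateFirst_succ_of_numBetter_ne_zero (i := i) (hsub hσ.1) hσ.2
    rw [ncard_inter_split _ _ fun σ => numBetter σ i = 0, winFirst_of_lt _ hn, w1]
    have w0' := w0
    simp only [hi] at w0' ⊢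
    rw [w0']
    simp only [hi] at c0 c1
    have hpos : (n : ℝ) + 1 ≠ 0 := by positivity
    generalize (if insert (⟨n, hn⟩ : Fin N) h ∈ τ then ((n : ℝ) + 1) / N
      else winFirst τ (n + 1) (insert ⟨n, hn⟩ h)) = x at *
    field_simp
    linear_combination x * c0 + winFirst τ (n + 1) h * c1

theorem ncard_inter_split_three (W E : Set (Equiv.Perm (Fin N)))
    (f : Equiv.Perm (Fin N) → ℕ) :
    ((W ∩ E).ncard : ℝ) = (W ∩ (E ∩ {σ | f σ = 0})).ncard + (W ∩ (E ∩ {σ | f σ = 1})).ncard +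
      (W ∩ (E ∩ {σ | 1 < f σ})).ncard := by
  have e1 : E ∩ {σ | ¬ f σ = 0} ∩ {σ | f σ = 1} = E ∩ {σ | f σ = 1} := by
    ext σ
    simp only [Set.mem_inter_iff, Set.mem_ofPred_eq, and_assoc]
    exact and_congr_right fun _ => by omega
  have e2 : E ∩ {σ | ¬ f σ = 0} ∩ {σ | ¬ f σ = 1} = E ∩ {σ | 1 < f σ} := by
    ext σ
    simp only [Set.mem_inter_iff, Set.mem_ofPred_eq, and_assoc]
    exact and_congr_right fun _ => by omega
  rw [ncard_inter_split W E fun σ => f σ = 0,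
    ncard_inter_split W (E ∩ {σ | ¬ f σ = 0}) fun σ => f σ = 1, ← add_assoc, e1, e2]

open Classical in
theorem ncard_wins_stateSecond (τ : Strategy N) (hn : n ≤ N) :
    ∀ {h : Finset (Fin N)} {E : Set (Equiv.Perm (Fin N))}, Determined n E →
      E ⊆ stateSecond n h →
        (({σ | Wins τ n σ} ∩ E).ncard : ℝ) = winSecond τ n h * E.ncard := by
  induction hn using Nat.decreasingInduction with
  | self =>
    intro h E _ _
    rw [wins_inter_self, winSecond_self]
    simp
  | of_succ n hn ih =>
    intro h E hE hsub
    rcases E.eq_empty_or_nonempty with rfl | ⟨σ₀, hσ₀⟩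
    · simp
    -- Relative rank 2 is possible for the next object only because Player 1's object is already
    -- present.
    have hn1 : 1 ≤ n := by
      obtain ⟨-, a, ha, -⟩ := hsub hσ₀
      omega
    set i : Fin N := ⟨n, hn⟩ with hi
    have c0 : ((n : ℝ) + 1) * (E ∩ {σ | numBetter σ i = 0}).ncard = E.ncard :=
      ncard_inter_numBetter (i := i) hE (Nat.zero_le _)
    have c1 : ((n : ℝ) + 1) * (E ∩ {σ | numBetter σ i = 1}).ncard = E.ncard :=
      ncard_inter_numBetter (i := i) hE hn1
    have c2 := ncard_inter_split_three Set.univ E (numBetter · i)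
    simp only [Set.univ_inter] at c2
    have hE' := hE.mono (Nat.le_succ n)
    have hst : ∀ σ ∈ E ∩ {σ | numBetter σ i = 0},
        IsCandidate σ i ∧ σ ∈ stateFirst (i.val + 1) (insert i h) := by
      rintro σ ⟨hσ, h0⟩
      obtain ⟨hh, a, ha, hp, -⟩ := hsub hσ
      exact stateFirst_succ_of_numBetter_eq_zero hp ha hh h0
    have w0 : (({σ | Wins τ n σ} ∩ (E ∩ {σ | numBetter σ i = 0})).ncard : ℝ) =
        (if insert i h ∈ τ then ((n : ℝ) + 1) / N else winFirst τ (n + 1) (insert i h)) *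
          (E ∩ {σ | numBetter σ i = 0}).ncard :=
      ncard_wins_of_numBetter_eq_zero (i := i) (hE'.inter (determined_numBetter i (· = 0)))
        (fun σ hσ => hσ.2) hst (fun hτ => if_pos hτ) (fun hτ => by
          rw [if_neg hτ]
          exact ncard_wins_stateFirst τ hn (hE'.inter (determined_numBetter i (· = 0)))
            fun σ hσ => (hst σ hσ).2)
    have hst1 := fun (σ : Equiv.Perm (Fin N)) (hσ : σ ∈ E ∩ {σ | numBetter σ i = 1}) =>
      stateSecond_succ_of_numBetter_eq_one (i := i) (hsub hσ.1) hσ.2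
    have w1 : (({σ | Wins τ n σ} ∩ (E ∩ {σ | numBetter σ i = 1})).ncard : ℝ) =
        (if insert i h ∈ τ then 0 else winSecond τ (n + 1) (insert i h)) *
          (E ∩ {σ | numBetter σ i = 1}).ncard := by
      by_cases hτ : insert i h ∈ τ
      · have := wins_inter_of_mem (i := i) (fun σ hσ => (hst1 σ hσ).1)
          (fun σ hσ => (hst1 σ hσ).2.1.1) hτ
        rw [if_pos hτ, zero_mul, Nat.cast_eq_zero, Set.ncard_eq_zero]
        refine this.trans ?_
        ext σ
        simp only [Set.mem_inter_iff, Set.mem_empty_iff_false, iff_false]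
        exact fun hσ => (hst1 σ hσ.1).2.2 hσ.2
      · rw [if_neg hτ, ← ih (hE'.inter (determined_numBetter i (· = 1)))
          fun σ hσ => (hst1 σ hσ).2.1]
        exact congrArg (fun s : Set _ => (s.ncard : ℝ))
          (wins_inter_of_notMem (i := i) (fun σ hσ => (hst1 σ hσ).2.1.1) hτ)
    have hst2 := fun (σ : Equiv.Perm (Fin N)) (hσ : σ ∈ E ∩ {σ | 1 < numBetter σ i}) =>
      stateSecond_succ_of_one_lt_numBetter (i := i) (hsub hσ.1) hσ.2
    have w2 : (({σ | Wins τ n σ} ∩ (E ∩ {σ | 1 < numBetter σ i})).ncard : ℝ) =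
        winSecond τ (n + 1) h * (E ∩ {σ | 1 < numBetter σ i}).ncard := by
      rw [← ih (hE'.inter (determined_numBetter i (1 < ·))) fun σ hσ => (hst2 σ hσ).2]
      exact congrArg (fun s : Set _ => (s.ncard : ℝ))
        (wins_inter_of_not_isCandidate (i := i) fun σ hσ => (hst2 σ hσ).1)
    rw [ncard_inter_split_three _ _ (numBetter · i), winSecond_of_lt _ hn, w2, w1, w0]
    have hpos : (n : ℝ) + 1 ≠ 0 := by positivity
    simp only [← hi]
    generalize (if insert i h ∈ τ then ((n : ℝ) + 1) / N
      else winFirst τ (n + 1) (insert i h)) = x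
    generalize (if insert i h ∈ τ then 0 else winSecond τ (n + 1) (insert i h)) = y
    field_simp
    linear_combination (x - winSecond τ (n + 1) h) * c0 + (y - winSecond τ (n + 1) h) * c1 -
      ((n : ℝ) + 1) * winSecond τ (n + 1) h * c2

theorem ncard_wins_stateNone (τ : Strategy N) (hn : n ≤ N) (hs : nStar N ≤ n + 1) :
    ∀ {h : Finset (Fin N)} {E : Set (Equiv.Perm (Fin N))}, Determined n E →
      E ⊆ stateNone n h → (({σ | Wins τ n σ} ∩ E).ncard : ℝ) = winNone τ n h * E.ncard := by
  induction hn using Nat.decreasingInduction with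
  | self =>
    intro h E _ _
    rw [wins_inter_self, winNone_self]
    simp
  | of_succ n hn ih =>
    intro h E hE hsub
    set i : Fin N := ⟨n, hn⟩ with hi
    have c0 : ((n : ℝ) + 1) * (E ∩ {σ | numBetter σ i = 0}).ncard = E.ncard :=
      ncard_inter_numBetter (i := i) hE (Nat.zero_le _)
    have c1 : ((n : ℝ) + 1) * (E ∩ {σ | ¬ numBetter σ i = 0}).ncard = n * E.ncard :=
      ncard_inter_numBetter_ne_zero (i := i) hE
    have hE' := hE.mono (Nat.le_succ n)
    have hst0 := fun (σ : Equiv.Perm (Fin N)) (hσ : σ ∈ E ∩ {σ | numBetter σ i = 0}) =>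
      stateNone_succ_of_numBetter_eq_zero (i := i) hs (hsub hσ.1) hσ.2
    have hst1 := fun (σ : Equiv.Perm (Fin N)) (hσ : σ ∈ E ∩ {σ | ¬ numBetter σ i = 0}) =>
      stateNone_succ_of_numBetter_ne_zero (i := i) (hsub hσ.1) hσ.2
    have w0 : (({σ | Wins τ n σ} ∩ (E ∩ {σ | numBetter σ i = 0})).ncard : ℝ) =
        winSecond τ (n + 1) h * (E ∩ {σ | numBetter σ i = 0}).ncard := by
      rw [← ncard_wins_stateSecond τ hn (hE'.inter (determined_numBetter i (· = 0)))
        fun σ hσ => (hst0 σ hσ).2]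
      exact congrArg (fun s : Set _ => (s.ncard : ℝ))
        (wins_inter_of_not_isCandidate (i := i) fun σ hσ => (hst0 σ hσ).1)
    have w1 : (({σ | Wins τ n σ} ∩ (E ∩ {σ | ¬ numBetter σ i = 0})).ncard : ℝ) =
        winNone τ (n + 1) h * (E ∩ {σ | ¬ numBetter σ i = 0}).ncard := by
      rw [← ih (by omega) (hE'.inter (determined_numBetter i (¬ · = 0)))
        fun σ hσ => (hst1 σ hσ).2]
      exact congrArg (fun s : Set _ => (s.ncard : ℝ))
        (wins_inter_of_not_isCandidate (i := i) fun σ hσ => (hst1 σ hσ).1)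
    rw [ncard_inter_split _ _ fun σ => numBetter σ i = 0, winNone, if_pos hn, w1, w0]
    have hpos : (n : ℝ) + 1 ≠ 0 := by positivity
    field_simp
    linear_combination winSecond τ (n + 1) h * c0 + winNone τ (n + 1) h * c1

end WinProbabilities

/-! ### Dynamic programming over beliefs and monotonicity in the belief. -/

/-- Player 2's optimal payoff after `n` objects, as a function of the masses `a` and `b` that his
belief puts on `stateFirst` and `stateSecond`; it is homogeneous in `(a, b)`. -/
noncomputable def optimalValue (N n : ℕ) (a b : ℝ) : ℝ :=
  if n < N then
    optimalValue N (n + 1) (n / (n + 1) * a) ((n - 1) / (n + 1) * b) +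
      max ((a + b) / N) (optimalValue N (n + 1) (1 / (n + 1) * (a + b)) (1 / (n + 1) * b))
  else 0
termination_by N - n

/-- Player 2's optimal payoff when neither player has accepted any of the first `n` objects. -/
noncomputable def optimalValueNone (N n : ℕ) : ℝ :=
  if n < N then
    n / (n + 1) * optimalValueNone N (n + 1) + 1 / (n + 1) * optimalValue N (n + 1) 0 1
  else 0
termination_by N - n

section Optimality

variable {N n : ℕ}

theorem optimalValue_self (N : ℕ) (a b : ℝ) : optimalValue N N a b = 0 := by
  rw [optimalValue, if_neg (lt_irrefl N)]

theorem optimalValueNone_self (N : ℕ) : optimalValueNone N N = 0 := by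
  rw [optimalValueNone, if_neg (lt_irrefl N)]

theorem optimalValue_of_lt (hn : n < N) (a b : ℝ) : optimalValue N n a b =
    optimalValue N (n + 1) (n / (n + 1) * a) ((n - 1) / (n + 1) * b) +
      max ((a + b) / N) (optimalValue N (n + 1) (1 / (n + 1) * (a + b)) (1 / (n + 1) * b)) := by
  rw [optimalValue, if_pos hn]

theorem win_le_optimalValue (τ : Strategy N) (hn : n ≤ N) : ∀ (h : Finset (Fin N)) (a b : ℝ),
    a * winFirst τ n h + b * winSecond τ n h ≤ optimalValue N n a b := by
  induction hn using Nat.decreasingInduction with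
  | self =>
    intro h a b
    rw [winFirst_self, winSecond_self, optimalValue_self]
    simp
  | of_succ n hn ih =>
    intro h a b
    rw [winFirst_of_lt _ hn, winSecond_of_lt _ hn, optimalValue_of_lt hn]
    have h1 := ih h (n / (n + 1) * a) ((n - 1) / (n + 1) * b)
    have h2 := ih (insert ⟨n, hn⟩ h) (1 / (n + 1) * (a + b)) (1 / (n + 1) * b)
    split_ifs with hτ
    · have h3 := le_max_left ((a + b) / N)
        (optimalValue N (n + 1) (1 / (n + 1) * (a + b)) (1 / (n + 1) * b))
      have h4 : 1 / ((n : ℝ) + 1) * (((n : ℝ) + 1) / N) = 1 / N := by field_simp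
      rw [h4]
      have h5 : (a + b) / N = a * (1 / (N : ℝ)) + b * (1 / N) := by ring
      linarith
    · have h3 := le_max_right ((a + b) / N)
        (optimalValue N (n + 1) (1 / (n + 1) * (a + b)) (1 / (n + 1) * b))
      linarith

/-- The strategies agree on the histories that extend `h` with at least one decision point
after the first `n` objects. -/
def AgreeAfter (n : ℕ) (h : Finset (Fin N)) (τ τ' : Strategy N) : Prop :=
  ∀ s : Finset (Fin N), (∀ j : Fin N, j.val < n → (j ∈ s ↔ j ∈ h)) → (∃ j ∈ s, n ≤ j.val) →
    (s ∈ τ ↔ s ∈ τ')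

theorem AgreeAfter.succ {h : Finset (Fin N)} {τ τ' : Strategy N} {i : Fin N}
    (ha : AgreeAfter i.val h τ τ') : AgreeAfter (i.val + 1) h τ τ' :=
  fun s hs ⟨j, hj, hij⟩ => ha s (fun k hk => hs k (by omega)) ⟨j, hj, by omega⟩

theorem AgreeAfter.succ_insert {h : Finset (Fin N)} {τ τ' : Strategy N} {i : Fin N}
    (ha : AgreeAfter i.val h τ τ') : AgreeAfter (i.val + 1) (insert i h) τ τ' := by
  refine fun s hs ⟨j, hj, hij⟩ => ha s (fun k hk => ?_) ⟨j, hj, by omega⟩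
  rw [hs k (by omega), Finset.mem_insert, or_iff_right]
  rintro rfl
  exact lt_irrefl _ hk

theorem AgreeAfter.insert_mem_iff {h : Finset (Fin N)} {τ τ' : Strategy N} {i : Fin N}
    (ha : AgreeAfter i.val h τ τ') : insert i h ∈ τ ↔ insert i h ∈ τ' := by
  refine ha _ (fun k hk => ?_) ⟨i, Finset.mem_insert_self _ _, le_rfl⟩
  rw [Finset.mem_insert, or_iff_right]
  rintro rfl
  exact lt_irrefl _ hk

/-- Future decisions are made only at histories that extend `h` by a new decision point. This allows
strategies for different branches to be glued together. -/
theorem win_congr {τ τ' : Strategy N} (hn : n ≤ N) : ∀ {h : Finset (Fin N)},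
    (∀ j ∈ h, j.val < n) → AgreeAfter n h τ τ' →
      winFirst τ n h = winFirst τ' n h ∧ winSecond τ n h = winSecond τ' n h := by
  induction hn using Nat.decreasingInduction with
  | self =>
    intro h _ _
    simp [winFirst_self, winSecond_self]
  | of_succ n hn ih =>
    intro h hh ha
    have h1 := ih (fun j hj => Nat.lt_succ_of_lt (hh j hj))
      (AgreeAfter.succ (i := ⟨n, hn⟩) ha)
    have h2 := ih (h := insert ⟨n, hn⟩ h) (fun j hj => by
      rcases Finset.mem_insert.1 hj with rfl | hj
      · exact Nat.lt_succ_self n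
      · exact Nat.lt_succ_of_lt (hh j hj)) (AgreeAfter.succ_insert (i := ⟨n, hn⟩) ha)
    have h3 := AgreeAfter.insert_mem_iff (i := ⟨n, hn⟩) ha
    simp only [winFirst_of_lt _ hn, winSecond_of_lt _ hn, h1, h2]
    by_cases hc : insert ⟨n, hn⟩ h ∈ τ
    · simp only [if_pos hc, if_pos (h3.1 hc), and_self]
    · simp only [if_neg hc, if_neg (mt h3.2 hc), and_self]

/-- Some strategy is optimal after every history of the first `n` objects. -/
theorem exists_win_eq_optimalValue (hn : n ≤ N) : ∀ a b : ℝ, ∃ τ : Strategy N,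
    ∀ h : Finset (Fin N), (∀ j ∈ h, j.val < n) →
      a * winFirst τ n h + b * winSecond τ n h = optimalValue N n a b := by
  induction hn using Nat.decreasingInduction with
  | self =>
    refine fun a b => ⟨∅, fun h _ => ?_⟩
    rw [winFirst_self, winSecond_self, optimalValue_self]
    simp
  | of_succ n hn ih =>
    intro a b
    set i : Fin N := ⟨n, hn⟩ with hi
    obtain ⟨τ₁, h₁⟩ := ih (n / (n + 1) * a) ((n - 1) / (n + 1) * b)
    obtain ⟨τ₂, h₂⟩ := ih (1 / (n + 1) * (a + b)) (1 / (n + 1) * b)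
    set acc : Prop := optimalValue N (n + 1) (1 / (n + 1) * (a + b)) (1 / (n + 1) * b) ≤
      (a + b) / N with hacc
    -- Play `τ₁` if `i` was no candidate and `τ₂` once a candidate has followed `i`; at `i` itself
    -- accept exactly when `acc` holds. None of this depends on `h`, so one strategy serves all
    -- histories.
    refine ⟨{s | (i ∉ s ∧ s ∈ τ₁) ∨ (i ∈ s ∧ (∃ j ∈ s, i < j) ∧ s ∈ τ₂) ∨
      (i ∈ s ∧ (∀ j ∈ s, j ≤ i) ∧ acc)}, fun h hh => ?_⟩
    set τ : Strategy N := {s | (i ∉ s ∧ s ∈ τ₁) ∨ (i ∈ s ∧ (∃ j ∈ s, i < j) ∧ s ∈ τ₂) ∨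
      (i ∈ s ∧ (∀ j ∈ s, j ≤ i) ∧ acc)} with hτ
    have hih : i ∉ h := fun hj => lt_irrefl _ (hh _ hj)
    have hh' : ∀ j ∈ insert i h, j.val < n + 1 := fun j hj => by
      rcases Finset.mem_insert.1 hj with rfl | hj
      · exact Nat.lt_succ_self n
      · exact Nat.lt_succ_of_lt (hh j hj)
    have hh'' : ∀ j ∈ h, j.val < n + 1 := fun j hj => Nat.lt_succ_of_lt (hh j hj)
    have g1 := win_congr (τ := τ) (τ' := τ₁) hn hh'' (by
      rintro s hs -
      have : i ∉ s := fun h' => hih ((hs i (Nat.lt_succ_self n)).1 h')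
      simp [hτ, this])
    have g2 := win_congr (τ := τ) (τ' := τ₂) hn hh' (by
      rintro s hs ⟨j, hj, hnj⟩
      have h3 : i ∈ s := (hs i (Nat.lt_succ_self n)).2 (Finset.mem_insert_self _ _)
      have h4 : ∃ j ∈ s, i < j := ⟨j, hj, hnj⟩
      have h5 : ¬ ∀ j ∈ s, j ≤ i := fun h' => not_le.2 (show i < j from hnj) (h' j hj)
      simp only [hτ, Set.mem_ofPred_eq, h3, iff_true_intro h4, iff_false_intro h5, not_true,
        false_and, true_and, false_or, or_false])
    have g3 : insert i h ∈ τ ↔ acc := by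
      have h3 : i ∈ insert i h := Finset.mem_insert_self _ _
      have h4 : ∀ j ∈ insert i h, j ≤ i := fun j hj => Nat.lt_succ_iff.1 (hh' j hj)
      have h5 : ¬ ∃ j ∈ insert i h, i < j := fun ⟨j, hj, hlt⟩ => not_le.2 hlt (h4 j hj)
      simp only [hτ, Set.mem_ofPred_eq, h3, iff_true_intro h4, iff_false_intro h5, not_true,
        false_and, true_and, false_or]
    have e1 := h₁ h hh''
    have e2 := h₂ (insert i h) hh'
    rw [winFirst_of_lt _ hn, winSecond_of_lt _ hn, optimalValue_of_lt hn, ← hi]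
    by_cases hc : acc
    · rw [if_pos (g3.2 hc), if_pos (g3.2 hc), max_eq_left hc, g1.1, g1.2, ← e1]
      have h4 : 1 / ((n : ℝ) + 1) * (((n : ℝ) + 1) / N) = 1 / N := by field_simp
      rw [h4]
      ring
    · rw [if_neg (mt g3.1 hc), if_neg (mt g3.1 hc), max_eq_right (not_le.1 hc).le, g1.1, g1.2,
        g2.1, g2.2, ← e1, ← e2]
      ring

theorem winNone_le_optimalValueNone (τ : Strategy N) (h : Finset (Fin N)) (hn : n ≤ N) :
    winNone τ n h ≤ optimalValueNone N n := by
  induction hn using Nat.decreasingInduction with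
  | self =>
    rw [winNone_self, optimalValueNone_self]
  | of_succ n hn ih =>
    rw [winNone, optimalValueNone, if_pos hn, if_pos hn]
    have := win_le_optimalValue τ hn h 0 1
    rw [zero_mul, zero_add, one_mul] at this
    gcongr

/-- The optimal value has a supporting linear functional that puts at least as much weight on
`stateFirst` as on `stateSecond`. -/
theorem exists_subgradient (hn : n ≤ N) : 2 ≤ n → ∀ {a b : ℝ}, 0 ≤ a → 0 ≤ b → 0 < a + b →
    ∃ α β : ℝ, 0 ≤ β ∧ β ≤ α ∧ optimalValue N n a b = α * a + β * b ∧
      ∀ a' b' : ℝ, 0 ≤ a' → 0 ≤ b' → 0 < a' + b' →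
        α * a' + β * b' ≤ optimalValue N n a' b' := by
  induction hn using Nat.decreasingInduction with
  | self =>
    intro _ a b _ _ _
    refine ⟨0, 0, le_rfl, le_rfl, ?_, fun a' b' _ _ _ => ?_⟩ <;>
    simp [optimalValue_self]
  | of_succ n hn ih =>
    intro h2 a b ha hb hab
    have h2' : (2 : ℝ) ≤ n := by exact_mod_cast h2
    have c1 : 0 < (n : ℝ) / (n + 1) := by positivity
    -- For `n = 1` this factor vanishes, and a belief with `a = 0` would leave no mass in the branch
    -- without a candidate.
    have c2 : 0 < ((n : ℝ) - 1) / (n + 1) := div_pos (by linarith) (by linarith)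
    have c3 : 0 < 1 / ((n : ℝ) + 1) := by positivity
    have c13 : (n : ℝ) / (n + 1) = ((n : ℝ) - 1) / (n + 1) + 1 / (n + 1) := by ring
    have pos1 : ∀ {x y : ℝ}, 0 ≤ x → 0 ≤ y → 0 < x + y →
        0 < (n : ℝ) / (n + 1) * x + (n - 1) / (n + 1) * y := by
      intro x y hx hy hxy
      rcases hx.eq_or_lt with rfl | hx
      · have : 0 < y := by linarith
        positivity
      · positivity
    have pos2 : ∀ {x y : ℝ}, 0 ≤ x → 0 ≤ y → 0 < x + y →
        0 < 1 / ((n : ℝ) + 1) * (x + y) + 1 / (n + 1) * y := by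
      intro x y hx hy hxy
      positivity
    obtain ⟨α₁, β₁, hβ₁, hαβ₁, heq₁, hle₁⟩ := ih (by omega)
      (a := n / (n + 1) * a) (b := (n - 1) / (n + 1) * b) (by positivity) (by positivity)
      (pos1 ha hb hab)
    obtain ⟨α₂, β₂, hβ₂, hαβ₂, heq₂, hle₂⟩ := ih (by omega)
      (a := 1 / (n + 1) * (a + b)) (b := 1 / (n + 1) * b) (by positivity) (by positivity)
      (pos2 ha hb hab)
    -- Otherwise `(α₂, β₂)` exceeds `(α₁, β₁)` in both coordinates and, the belief mass being
    -- positive, passes above the value at the belief where `(α₁, β₁)` attains it.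
    have hα : β₂ ≤ α₁ := by
      by_contra! hcon
      have h3 := hle₂ (n / (n + 1) * a) ((n - 1) / (n + 1) * b) (by positivity) (by positivity)
        (pos1 ha hb hab)
      rw [heq₁] at h3
      have h4 : 0 < (α₂ - α₁) * (n / (n + 1) * a) + (β₂ - β₁) * ((n - 1) / (n + 1) * b) := by
        have h5 : 0 < α₂ - α₁ := by linarith
        have h6 : 0 < β₂ - β₁ := by linarith
        rcases ha.eq_or_lt with rfl | ha
        · have : 0 < b := by linarith
          positivity
        · positivity
      linarith
    by_cases hc : optimalValue N (n + 1) (1 / (n + 1) * (a + b)) (1 / (n + 1) * b) ≤ (a + b) / N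
    · refine ⟨n / (n + 1) * α₁ + 1 / N, (n - 1) / (n + 1) * β₁ + 1 / N, by positivity, ?_, ?_, ?_⟩
      · rw [c13]
        have h3 := mul_le_mul_of_nonneg_left hαβ₁ c2.le
        have h4 : 0 ≤ 1 / ((n : ℝ) + 1) * α₁ := mul_nonneg c3.le (hβ₁.trans hαβ₁)
        linarith
      · rw [optimalValue_of_lt hn, max_eq_left hc, heq₁]
        ring
      · intro a' b' ha' hb' hab'
        rw [optimalValue, if_pos hn]
        have h3 := hle₁ (n / (n + 1) * a') ((n - 1) / (n + 1) * b') (by positivity)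
          (by positivity) (pos1 ha' hb' hab')
        have h4 := le_max_left ((a' + b') / N)
          (optimalValue N (n + 1) (1 / (n + 1) * (a' + b')) (1 / (n + 1) * b'))
        have h5 : (a' + b') / N = 1 / (N : ℝ) * a' + 1 / N * b' := by ring
        linarith
    -- The difference of the two coefficients is `((n - 1) (α₁ - β₁) + (α₁ - β₂)) / (n + 1)`; this
    -- is where `hα` enters.
    · refine ⟨n / (n + 1) * α₁ + 1 / (n + 1) * α₂,
        (n - 1) / (n + 1) * β₁ + 1 / (n + 1) * (α₂ + β₂), ?_, ?_, ?_, ?_⟩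
      · have : 0 ≤ α₂ := hβ₂.trans hαβ₂
        positivity
      · rw [c13]
        have h3 := mul_le_mul_of_nonneg_left hαβ₁ c2.le
        have h4 := mul_le_mul_of_nonneg_left hα c3.le
        linarith
      · rw [optimalValue_of_lt hn, max_eq_right (not_le.1 hc).le, heq₁, heq₂]
        ring
      · intro a' b' ha' hb' hab'
        rw [optimalValue, if_pos hn]
        have h3 := hle₁ (n / (n + 1) * a') ((n - 1) / (n + 1) * b') (by positivity)
          (by positivity) (pos1 ha' hb' hab')
        have h4 := le_max_right ((a' + b') / N)
          (optimalValue N (n + 1) (1 / (n + 1) * (a' + b')) (1 / (n + 1) * b'))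
        have h5 := hle₂ (1 / (n + 1) * (a' + b')) (1 / (n + 1) * b') (by positivity)
          (by positivity) (pos2 ha' hb' hab')
        linarith

/-- The functional supporting the value at `p` is non-decreasing in the belief because `β ≤ α`, and
it bounds the value at `q` from below. -/
theorem monotoneOn_optimalValue (h2 : 2 ≤ n) (hn : n ≤ N) :
    MonotoneOn (fun p => optimalValue N n p (1 - p)) (Set.Icc 0 1) := by
  rintro p ⟨hp0, hp1⟩ q ⟨hq0, hq1⟩ hpq
  obtain ⟨α, β, -, hαβ, heq, hle⟩ := exists_subgradient hn h2 hp0 (sub_nonneg.2 hp1) (by linarith)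
  have h1 := hle q (1 - q) hq0 (sub_nonneg.2 hq1) (by linarith)
  have h3 := mul_le_mul_of_nonneg_right hαβ (sub_nonneg.2 hpq)
  simp only
  linarith

theorem optimalValue_mul {c : ℝ} (hc : 0 ≤ c) (hn : n ≤ N) : ∀ a b : ℝ,
    optimalValue N n (c * a) (c * b) = c * optimalValue N n a b := by
  induction hn using Nat.decreasingInduction with
  | self => simp [optimalValue_self]
  | of_succ n hn ih =>
    intro a b
    rw [optimalValue_of_lt hn, optimalValue_of_lt hn, mul_add c, ← ih, mul_max_of_nonneg _ _ hc,
      ← ih]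
    congr 2 <;> ring_nf

/-- By homogeneity: a candidate has mass `2 / (n + 1)`, and its relative rank is then 1 or 2 with
equal probability. -/
theorem optimalValue_zero_one (h2 : 2 ≤ n) (hn : n < N) :
    optimalValue N n 0 1 = (n - 1) / (n + 1) * optimalValue N (n + 1) 0 1 +
      max (1 / (N : ℝ)) (2 / (n + 1) * optimalValue N (n + 1) (1 / 2) (1 - 1 / 2)) := by
  have h2' : (2 : ℝ) ≤ n := by exact_mod_cast h2
  have c2 : 0 ≤ ((n : ℝ) - 1) / (n + 1) := div_nonneg (by linarith) (by linarith)
  rw [optimalValue_of_lt hn, ← optimalValue_mul c2 (Nat.succ_le_of_lt hn),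
    ← optimalValue_mul (by positivity) (Nat.succ_le_of_lt hn), Nat.succ_eq_add_one]
  ring_nf

/-- Rejecting the next candidate leads to belief `1 / 2`, worth at least belief `0` by monotonicity.
The weak inequality is carried along because at `n = N` both values are zero. -/
theorem optimalValueNone_le_and_lt (hn : n ≤ N) : 2 ≤ n →
    optimalValueNone N n ≤ optimalValue N n 0 1 ∧
      (n < N → optimalValueNone N n < optimalValue N n 0 1) := by
  induction hn using Nat.decreasingInduction with
  | self => simp [optimalValueNone_self, optimalValue_self]
  | of_succ n hn ih =>
    intro h2
    have h2' : (2 : ℝ) ≤ n := by exact_mod_cast h2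
    obtain ⟨hle, hlt⟩ := ih (by omega)
    have hN : 0 < N := by omega
    have c2 : 0 < ((n : ℝ) - 1) / (n + 1) := div_pos (by linarith) (by linarith)
    have c3 : 0 < 1 / ((n : ℝ) + 1) := by positivity
    suffices h : optimalValueNone N n < optimalValue N n 0 1 from ⟨h.le, fun _ => h⟩
    rw [optimalValueNone, if_pos hn, optimalValue_zero_one h2 hn]
    rcases (Nat.succ_le_of_lt hn).eq_or_lt with heq | hlt'
    · subst heq
      simp only [optimalValueNone_self, optimalValue_self, Nat.succ_eq_add_one]
      have : 0 < 1 / ((n + 1 : ℕ) : ℝ) := by positivity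
      simpa only [mul_zero, add_zero, zero_add] using lt_max_of_lt_left this
    · have h3 := hlt hlt'
      have h4 := le_max_right (1 / (N : ℝ))
        (2 / (n + 1) * optimalValue N (n + 1) (1 / 2) (1 - 1 / 2))
      have h5 := monotoneOn_optimalValue (n := n + 1) (by omega) hn
        (show (0 : ℝ) ∈ Set.Icc 0 1 by simp) (show (1 / 2 : ℝ) ∈ Set.Icc 0 1 by norm_num)
        (by norm_num)
      simp only [sub_zero] at h5
      have h6 := mul_le_mul_of_nonneg_left h5 c3.le
      have h7 := mul_lt_mul_of_pos_left h3 c2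
      have h8 := mul_le_mul_of_nonneg_left hle c3.le
      have e1 : (n : ℝ) / (n + 1) = ((n : ℝ) - 1) / (n + 1) + 1 / (n + 1) := by ring
      have e2 : (2 : ℝ) / (n + 1) = 2 * (1 / (n + 1)) := by ring
      rw [e2] at h4 ⊢
      rw [e1]
      linarith

end Optimality

/-! ### Lower bounds for `n*`. -/

section SecretaryValue

variable {N : ℕ}

theorem secretaryRem_succ (N m : ℕ) : secretaryRem N (m + 1) = secretaryRem N m +
    1 / (((N - (m + 1) : ℕ) : ℝ) + 1) *
      (max ((((N - (m + 1) : ℕ) : ℝ) + 1) / N) (secretaryRem N m) - secretaryRem N m) := by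
  rw [secretaryRem]
  field_simp
  ring

theorem monotone_secretaryRem (N : ℕ) : Monotone (secretaryRem N) := by
  refine monotone_nat_of_le_succ fun m => ?_
  rw [secretaryRem_succ]
  have h1 := sub_nonneg.2 (le_max_right ((((N - (m + 1) : ℕ) : ℝ) + 1) / N) (secretaryRem N m))
  have h2 : 0 ≤ 1 / (((N - (m + 1) : ℕ) : ℝ) + 1) := by positivity
  nlinarith [mul_nonneg h2 h1]

theorem secretaryRem_one (hN : 1 ≤ N) : secretaryRem N 1 = 1 / N := by
  have hN' : (0 : ℝ) < N := by exact_mod_cast hN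
  rw [secretaryRem_succ, secretaryRem, zero_add, Nat.cast_sub hN, Nat.cast_one, sub_add_cancel,
    div_self hN'.ne', max_eq_left zero_le_one]
  ring

theorem one_div_lt_secretaryRem_two (hN : 3 ≤ N) : 1 / (N : ℝ) < secretaryRem N 2 := by
  have hN' : (3 : ℝ) ≤ N := by exact_mod_cast hN
  rw [secretaryRem_succ, secretaryRem_one (by omega), lt_add_iff_pos_right]
  refine mul_pos (by positivity) (sub_pos.2 (lt_max_of_lt_left ?_))
  rw [Nat.cast_sub (by omega)]
  push_cast
  gcongr
  linarith

theorem secretaryValue_nStar_le (hN : 1 ≤ N) :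
    secretaryValue N (nStar N) ≤ (nStar N : ℝ) / N := by
  refine Nat.sInf_mem (s := {n : ℕ | secretaryValue N n ≤ (n : ℝ) / N}) ⟨N, ?_⟩
  simp only [Set.mem_ofPred_eq, secretaryValue, Nat.sub_self, secretaryRem]
  positivity

theorem one_le_nStar (hN : 1 ≤ N) : 1 ≤ nStar N := by
  by_contra! hcon
  have h1 := secretaryValue_nStar_le hN
  rw [Nat.lt_one_iff.1 hcon, secretaryValue, Nat.cast_zero, zero_div, Nat.sub_zero] at h1
  have h2 := monotone_secretaryRem N hN
  rw [secretaryRem_one hN] at h2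
  have h3 : (0 : ℝ) < 1 / N := by
    have : (0 : ℝ) < N := by exact_mod_cast hN
    positivity
  linarith

/-- Needed because with `n* = 1` Player 1 takes the first object, the second is always a candidate,
and the event conditioned on in `valueZero` is empty for `n ≥ 2`. -/
theorem two_le_nStar (hN : 3 ≤ N) : 2 ≤ nStar N := by
  by_contra! hcon
  have h1 := secretaryValue_nStar_le (N := N) (by omega)
  have h0 := one_le_nStar (N := N) (by omega)
  rw [show nStar N = 1 by omega, secretaryValue, Nat.cast_one] at h1
  have h2 := monotone_secretaryRem N (show 2 ≤ N - 1 by omega)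
  have h3 := one_div_lt_secretaryRem_two hN
  linarith

end SecretaryValue

/-! ### From histories to beliefs. -/

section Histories

variable {N n : ℕ} {σ : Equiv.Perm (Fin N)} {h : Finset (Fin N)} {i : Fin N}

theorem mem_stateFirst_or_mem_stateSecond {a : Fin N} (ha : PlayerOneAccepts σ a)
    (han : a.val < n) (hh : candidatesBefore σ n = h) :
    σ ∈ stateFirst n h ∨ σ ∈ stateSecond n h := by
  by_cases hj : ∃ j : Fin N, j.val < n ∧ σ j < σ a
  · exact Or.inl ⟨hh, a, han, ha, hj⟩
  · push Not at hj
    exact Or.inr ⟨hh, a, han, ha, hj⟩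

/-- After moment `n*`, a candidate only appears when Player 1 has accepted an object. -/
theorem exists_playerOneAccepts_of_isCandidate (hn : nStar N < i.val + 1)
    (hc : IsCandidate σ i) : ∃ a < i, PlayerOneAccepts σ a := by
  by_contra! hcon
  have hσ : σ ∈ stateNone i.val (candidatesBefore σ i.val) := ⟨rfl, hcon⟩
  by_cases h0 : numBetter σ i = 0
  · exact (stateNone_succ_of_numBetter_eq_zero hn.le hσ h0).1 hc
  · exact (stateNone_succ_of_numBetter_ne_zero hσ h0).1 hc

theorem mem_state_of_mem_historyEvent (hn : nStar N < i.val + 1) (hσ : σ ∈ historyEvent i h) :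
    (relRank σ i = 1 ∧ σ ∈ stateFirst (i.val + 1) h) ∨
      (relRank σ i = 2 ∧ σ ∈ stateSecond (i.val + 1) h) := by
  obtain ⟨hc, hh⟩ := hσ
  obtain ⟨a, hai, ha⟩ := exists_playerOneAccepts_of_isCandidate hn hc
  rw [history_eq_candidatesBefore, candidatesBefore_succ_of_isCandidate hc] at hh
  rw [relRank_eq_numBetter_add_one]
  by_cases h0 : numBetter σ i = 0
  · exact Or.inl ⟨by rw [h0], hh ▸ (stateFirst_succ_of_numBetter_eq_zero ha hai rfl h0).2⟩
  · have hs : σ ∈ stateSecond i.val (candidatesBefore σ i.val) :=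
      (mem_stateFirst_or_mem_stateSecond ha hai rfl).resolve_left fun hs =>
        not_isCandidate_of_mem_stateFirst hs h0 hc
    by_cases h1 : numBetter σ i = 1
    · exact Or.inr ⟨by rw [h1], hh ▸ (stateSecond_succ_of_numBetter_eq_one hs h1).2.1⟩
    · exact absurd hc (stateSecond_succ_of_one_lt_numBetter hs (by omega)).1

/-- Each step of a history can be imitated while Player 1's object remains best: a candidate by
relative rank 2, a non-candidate by relative rank 3. -/
theorem stateSecond_nonempty_of_stateFirst_nonempty (hn : n ≤ N) :
    ∀ {h : Finset (Fin N)}, (stateFirst n h).Nonempty → (stateSecond n h).Nonempty := by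
  induction n with
  | zero =>
    rintro h ⟨σ, -, a, ha, -⟩
    exact absurd ha (Nat.not_lt_zero _)
  | succ n ih =>
    rintro h ⟨σ, hh, a, ha, hp, j, hj, hlt⟩
    set i : Fin N := ⟨n, hn⟩
    have hai : a < i := by
      refine lt_of_le_of_ne (Nat.lt_succ_iff.1 ha) ?_
      rintro rfl
      exact hlt.not_ge (hp.le (Nat.lt_succ_iff.1 hj))
    have hmem : σ ∈ stateFirst i.val (candidatesBefore σ i.val) ∨
        σ ∈ stateSecond i.val (candidatesBefore σ i.val) :=
      mem_stateFirst_or_mem_stateSecond hp hai rfl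
    obtain ⟨σ', hσ'⟩ : (stateSecond i.val (candidatesBefore σ i.val)).Nonempty :=
      hmem.elim (fun hm => ih (by omega) ⟨σ, hm⟩) fun hm => ⟨σ, hm⟩
    by_cases h0 : numBetter σ i = 0
    · obtain ⟨ω, hω, h1⟩ := exists_sameOrder_numBetter_eq σ' i (r := 1)
        (Nat.one_le_of_lt hai)
      have hs := (stateSecond_succ_of_numBetter_eq_one
        (determined_stateSecond _ _ _ _ hω hσ') h1).2.1
      rw [← candidatesBefore_succ_of_isCandidate (isCandidate_of_numBetter_eq_zero hp hai h0)] at hs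
      exact ⟨ω, hh ▸ hs⟩
    · rcases hmem with hm | hm
      · have hc := not_isCandidate_of_mem_stateFirst hm h0
        have hn2 : 2 ≤ i.val := by
          obtain ⟨-, b, hb, -, k, hk, hkb⟩ := hm
          have : k.val ≠ b.val := fun h' => hkb.ne (congrArg σ (Fin.ext h'))
          omega
        obtain ⟨ω, hω, h2⟩ := exists_sameOrder_numBetter_eq σ' i (r := 2) hn2
        have hs := (stateSecond_succ_of_one_lt_numBetter
          (determined_stateSecond _ _ _ _ hω hσ') (by omega)).2
        rw [← candidatesBefore_succ_of_not_isCandidate hc] at hs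
        exact ⟨ω, hh ▸ hs⟩
      · obtain ⟨-, b, hb, hpb, hle⟩ := hm
        rw [hpb.unique hp] at hle
        exact absurd hlt
          (le_of_mem_stateSecond_of_numBetter_ne_zero hle h0 j hj).not_gt

/-- Ensures that neither conditional probability in `beliefValue` is `0 / 0`. -/
theorem historyRankEvent_nonempty (hn : nStar N < i.val + 1) (hne : (historyEvent i h).Nonempty) :
    (historyRankEvent i h 1).Nonempty ∧ (historyRankEvent i h 2).Nonempty := by
  obtain ⟨σ, hc, hh⟩ := hne
  obtain ⟨a, hai, ha⟩ := exists_playerOneAccepts_of_isCandidate hn hc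
  rw [history_eq_candidatesBefore, candidatesBefore_succ_of_isCandidate hc] at hh
  constructor
  · obtain ⟨ω, hω, h0⟩ := exists_sameOrder_numBetter_eq σ i (Nat.zero_le _)
    obtain ⟨hcω, hsω⟩ := stateFirst_succ_of_numBetter_eq_zero
      ((hω.playerOneAccepts_iff hai).1 ha) hai hω.candidatesBefore_eq.symm h0
    refine ⟨ω, ⟨hcω, ?_⟩, by rw [relRank_eq_numBetter_add_one, h0]⟩
    rw [history_eq_candidatesBefore, hsω.1, hh]
  · obtain ⟨σ', hσ'⟩ : (stateSecond i.val (candidatesBefore σ i.val)).Nonempty :=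
      (mem_stateFirst_or_mem_stateSecond ha hai rfl).elim
        (fun hm => stateSecond_nonempty_of_stateFirst_nonempty i.isLt.le ⟨σ, hm⟩)
        fun hm => ⟨σ, hm⟩
    obtain ⟨ω, hω, h1⟩ := exists_sameOrder_numBetter_eq σ' i (r := 1) (Nat.one_le_of_lt hai)
    obtain ⟨hcω, hsω, -⟩ := stateSecond_succ_of_numBetter_eq_one
        (determined_stateSecond _ _ _ _ hω hσ') h1
    refine ⟨ω, ⟨hcω, ?_⟩, by rw [relRank_eq_numBetter_add_one, h1]⟩
    rw [history_eq_candidatesBefore, hsω.1, hh]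

theorem determined_historyRankEvent (i : Fin N) (h : Finset (Fin N)) (r : ℕ) :
    Determined (i.val + 1) (historyRankEvent i h r) := by
  rintro σ σ' hs ⟨⟨hc, hh⟩, hr⟩
  rw [history_eq_candidatesBefore, hs.candidatesBefore_eq] at hh
  refine ⟨⟨(hs.isCandidate_iff (Nat.lt_succ_self _)).1 hc, ?_⟩, ?_⟩
  · rw [history_eq_candidatesBefore, hh]
  · rw [← hs.relRank_eq (Nat.lt_succ_self _), hr]

theorem historyRankEvent_one_subset (hn : nStar N < i.val + 1) :
    historyRankEvent i h 1 ⊆ stateFirst (i.val + 1) h := by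
  rintro σ ⟨hσ, hr⟩
  rcases mem_state_of_mem_historyEvent hn hσ with ⟨-, hs⟩ | ⟨hr', -⟩
  · exact hs
  · omega

theorem historyRankEvent_two_subset (hn : nStar N < i.val + 1) :
    historyRankEvent i h 2 ⊆ stateSecond (i.val + 1) h := by
  rintro σ ⟨hσ, hr⟩
  rcases mem_state_of_mem_historyEvent hn hσ with ⟨hr', -⟩ | ⟨-, hs⟩
  · omega
  · exact hs

theorem ncard_wins_historyRankEvent_one (τ : Strategy N) (hn : nStar N < i.val + 1) :
    (({σ | Wins τ (i.val + 1) σ} ∩ historyRankEvent i h 1).ncard : ℝ) =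
      winFirst τ (i.val + 1) h * (historyRankEvent i h 1).ncard :=
  ncard_wins_stateFirst τ i.isLt (determined_historyRankEvent i h 1)
    (historyRankEvent_one_subset hn)

theorem ncard_wins_historyRankEvent_two (τ : Strategy N) (hn : nStar N < i.val + 1) :
    (({σ | Wins τ (i.val + 1) σ} ∩ historyRankEvent i h 2).ncard : ℝ) =
      winSecond τ (i.val + 1) h * (historyRankEvent i h 2).ncard :=
  ncard_wins_stateSecond τ i.isLt (determined_historyRankEvent i h 2)
    (historyRankEvent_two_subset hn)

theorem ncard_pos_of_nonempty {E : Set (Equiv.Perm (Fin N))} (hE : E.Nonempty) :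
    (0 : ℝ) < E.ncard := by
  exact_mod_cast (Set.ncard_pos).2 hE

theorem iSup_eq_optimalValue (hn : n ≤ N) (hh : ∀ j ∈ h, j.val < n) (a b : ℝ) :
    ⨆ τ : Strategy N, (a * winFirst τ n h + b * winSecond τ n h) = optimalValue N n a b := by
  have hle := fun τ : Strategy N => win_le_optimalValue τ hn h a b
  obtain ⟨τ, hτ⟩ := exists_win_eq_optimalValue hn a b
  refine le_antisymm (ciSup_le hle) ?_
  rw [← hτ h hh]
  exact le_ciSup (f := fun τ : Strategy N => a * winFirst τ n h + b * winSecond τ n h)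
    ⟨_, Set.forall_mem_range.2 hle⟩ τ

theorem lt_of_mem_of_historyEvent_nonempty (hne : (historyEvent i h).Nonempty) :
    ∀ j ∈ h, j.val < i.val + 1 := by
  obtain ⟨σ, -, hh⟩ := hne
  intro j hj
  rw [← hh, history_eq_candidatesBefore, mem_candidatesBefore] at hj
  exact hj.1

theorem beliefValue_eq_optimalValue (hn : nStar N < i.val + 1)
    (hne : (historyEvent i h).Nonempty) (p : ℝ) :
    beliefValue i h p = optimalValue N (i.val + 1) p (1 - p) := by
  obtain ⟨h1, h2⟩ := historyRankEvent_nonempty hn hne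
  rw [← iSup_eq_optimalValue i.isLt (lt_of_mem_of_historyEvent_nonempty hne), beliefValue]
  refine iSup_congr fun τ => ?_
  rw [condProb, condProb, ncard_wins_historyRankEvent_one τ hn,
    ncard_wins_historyRankEvent_two τ hn, mul_div_cancel_right₀ _ (ncard_pos_of_nonempty h1).ne',
    mul_div_cancel_right₀ _ (ncard_pos_of_nonempty h2).ne']

/-- For each strategy this is the law of total probability over relative ranks 1 and 2. -/
theorem historyValue_eq_optimalValue (hn : nStar N < i.val + 1)
    (hne : (historyEvent i h).Nonempty) :
    historyValue i h = optimalValue N (i.val + 1) (posterior i h) (1 - posterior i h) := by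
  have e1 : historyEvent i h ∩ {σ | relRank σ i = 1} = historyRankEvent i h 1 := rfl
  have e2 : historyEvent i h ∩ {σ | ¬ relRank σ i = 1} = historyRankEvent i h 2 := by
    ext σ
    refine and_congr_right fun hσ => ?_
    have := mem_state_of_mem_historyEvent hn hσ
    simp only [Set.mem_ofPred_eq]
    omega
  have hpos := ncard_pos_of_nonempty hne
  rw [← iSup_eq_optimalValue i.isLt (lt_of_mem_of_historyEvent_nonempty hne), historyValue]
  refine iSup_congr fun τ => ?_
  have h1 := ncard_inter_add_ncard_inter_compl (historyEvent i h) fun σ => relRank σ i = 1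
  have h2 := ncard_inter_split {σ | Wins τ (i.val + 1) σ} (historyEvent i h)
    fun σ => relRank σ i = 1
  rw [e1, e2] at h1 h2
  rw [ncard_wins_historyRankEvent_one τ hn, ncard_wins_historyRankEvent_two τ hn] at h2
  rw [posterior, condProb, condProb, h2, Set.inter_comm, e1]
  field_simp
  linear_combination winSecond τ (i.val + 1) h * h1

end Histories

/-! ### The values `v(n, 0)` and `v(n, -1)`. -/

section WithoutCandidates

variable {N n : ℕ}

open Classical in
theorem ncard_eq_sum_candidatesBefore (A : Set (Equiv.Perm (Fin N))) (n : ℕ) :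
    (A.ncard : ℝ) = ∑ h : Finset (Fin N), ((A ∩ {σ | candidatesBefore σ n = h}).ncard : ℝ) := by
  rw [Set.ncard_eq_toFinset_card', Finset.card_eq_sum_card_fiberwise
    (f := fun σ => candidatesBefore σ n) (t := Finset.univ) fun _ _ => Finset.mem_univ _,
    Nat.cast_sum]
  refine Finset.sum_congr rfl fun h _ => ?_
  rw [Set.ncard_eq_toFinset_card']
  congr 2
  ext σ
  simp

theorem determined_candidatesBefore (n : ℕ) (h : Finset (Fin N)) :
    Determined n {σ : Equiv.Perm (Fin N) | candidatesBefore σ n = h} :=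
  fun _ _ hs hσ => hs.candidatesBefore_eq.symm.trans hσ

/-- Player 1 has accepted one of the first `n` objects and no candidate has appeared since `n*`. -/
def noCandidateEvent (N n : ℕ) : Set (Equiv.Perm (Fin N)) :=
  {σ | (∃ i : Fin N, i.val < n ∧ PlayerOneAccepts σ i) ∧
    ∀ j : Fin N, nStar N ≤ j.val + 1 → j.val < n → ¬ IsCandidate σ j}

theorem determined_noCandidateEvent (N n : ℕ) : Determined n (noCandidateEvent N n) := by
  rintro σ σ' hs ⟨⟨a, ha, hp⟩, hc⟩
  exact ⟨⟨a, ha, (hs.playerOneAccepts_iff ha).1 hp⟩,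
    fun j hj hjn hcj => hc j hj hjn ((hs.isCandidate_iff hjn).2 hcj)⟩

/-- The first object to beat Player 1's would be a candidate, so his object is still the best. -/
theorem noCandidateEvent_inter_subset (n : ℕ) (h : Finset (Fin N)) :
    noCandidateEvent N n ∩ {σ | candidatesBefore σ n = h} ⊆ stateSecond n h := by
  rintro σ ⟨⟨⟨a, ha, hp⟩, hc⟩, hh⟩
  refine ⟨hh, a, ha, hp, fun j => ?_⟩
  induction j using WellFoundedLT.induction with
  | ind j ih =>
    intro hj
    rcases le_or_gt j a with hja | haj
    · exact hp.le hja
    · by_contra! hlt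
      have haj' : a.val < j.val := haj
      refine hc j (hp.1.1.trans (by omega)) hj ⟨not_playerOneAccepts_of_lt hp haj, fun k hk _ => ?_⟩
      exact hlt.trans_le (ih k hk (lt_trans hk hj))

theorem noCandidateEvent_nonempty (h2 : 2 ≤ nStar N) (hn : nStar N < n) (hN : n ≤ N) :
    (noCandidateEvent N n).Nonempty := by
  set z : Fin N := ⟨0, by omega⟩ with hz
  set s : Fin N := ⟨nStar N - 1, by omega⟩ with hs
  have hzs : z ≠ s := by
    rw [hz, hs, ne_eq, Fin.mk.injEq]
    omega
  -- The best object appears at moment `n*`. All later ones are worse than the first object, which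
  -- Player 2 has seen.
  set σ : Equiv.Perm (Fin N) := Equiv.swap z s with hσ
  have hσs : σ s = z := Equiv.swap_apply_right z s
  have hσz : σ z = s := Equiv.swap_apply_left z s
  have hp : PlayerOneAccepts σ s := by
    refine ⟨⟨by simp only [hs]; omega, ?_⟩, fun j hj hcon => ?_⟩
    · rw [relRank_eq_numBetter_add_one, Nat.add_eq_right, numBetter_eq_zero_iff]
      intro j hj
      refine lt_of_le_of_ne ?_ fun h' => hj.ne' (σ.injective h')
      rw [hσs]
      exact Nat.zero_le _
    · have : j.val < nStar N - 1 := hj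
      omega
  refine ⟨σ, ⟨s, by simp only [hs]; omega, hp⟩, fun j hj _ hc => ?_⟩
  rcases eq_or_ne j s with rfl | hjs
  · exact hc.1 hp
  · have hsj : s < j :=
      lt_of_le_of_ne (show nStar N - 1 ≤ j.val by omega) hjs.symm
    have hzj : z < j := lt_of_le_of_lt (Nat.zero_le _) hsj
    have h1 := hc.2 z hzj fun h' => hzs (h'.unique hp)
    rw [hσz, hσ, Equiv.swap_apply_of_ne_of_ne hzj.ne' hjs] at h1
    exact h1.asymm hsj

theorem ncard_wins_noCandidateEvent_le (τ : Strategy N) (hn : n ≤ N) :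
    (({σ | Wins τ n σ} ∩ noCandidateEvent N n).ncard : ℝ) ≤
      optimalValue N n 0 1 * (noCandidateEvent N n).ncard := by
  rw [ncard_eq_sum_candidatesBefore (_ ∩ _) n,
    ncard_eq_sum_candidatesBefore (noCandidateEvent N n) n, Finset.mul_sum]
  refine Finset.sum_le_sum fun h _ => ?_
  rw [Set.inter_assoc, ncard_wins_stateSecond τ hn ((determined_noCandidateEvent N n).inter
    (determined_candidatesBefore n h)) (noCandidateEvent_inter_subset n h)]
  have := win_le_optimalValue τ hn h 0 1
  rw [zero_mul, zero_add, one_mul] at this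
  gcongr

theorem exists_ncard_wins_noCandidateEvent_eq (hn : n ≤ N) : ∃ τ : Strategy N,
    (({σ | Wins τ n σ} ∩ noCandidateEvent N n).ncard : ℝ) =
      optimalValue N n 0 1 * (noCandidateEvent N n).ncard := by
  obtain ⟨τ, hτ⟩ := exists_win_eq_optimalValue hn 0 1
  refine ⟨τ, ?_⟩
  rw [ncard_eq_sum_candidatesBefore (_ ∩ _) n,
    ncard_eq_sum_candidatesBefore (noCandidateEvent N n) n, Finset.mul_sum]
  refine Finset.sum_congr rfl fun h _ => ?_
  rw [Set.inter_assoc, ncard_wins_stateSecond τ hn ((determined_noCandidateEvent N n).inter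
    (determined_candidatesBefore n h)) (noCandidateEvent_inter_subset n h)]
  rcases (noCandidateEvent N n ∩ {σ | candidatesBefore σ n = h}).eq_empty_or_nonempty
    with he | ⟨σ, -, hσ⟩
  · rw [he]
    simp
  · have := hτ h fun j hj => by
      rw [← (show candidatesBefore σ n = h from hσ), mem_candidatesBefore] at hj
      exact hj.1
    rw [zero_mul, zero_add, one_mul] at this
    rw [this]

theorem valueZero_eq_optimalValue (hn : nStar N < n) (hN : n ≤ N) :
    valueZero N n = optimalValue N n 0 1 := by
  change ⨆ τ : Strategy N, condProb {σ | Wins τ n σ} (noCandidateEvent N n) = _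
  -- At `n = N` both sides vanish even if the event is empty; `n < N` forces `N ≥ 3`, so that
  -- `two_le_nStar` applies.
  rcases hN.eq_or_lt with rfl | hlt
  · simp [condProb, wins_inter_self, optimalValue_self]
  have h1 := one_le_nStar (N := N) (by omega)
  have hpos := ncard_pos_of_nonempty
    (noCandidateEvent_nonempty (two_le_nStar (by omega)) hn hN)
  have hle : ∀ τ : Strategy N, condProb {σ | Wins τ n σ} (noCandidateEvent N n) ≤
      optimalValue N n 0 1 := fun τ =>
    (div_le_iff₀ hpos).2 (ncard_wins_noCandidateEvent_le τ hN)
  obtain ⟨τ, hτ⟩ := exists_ncard_wins_noCandidateEvent_eq hN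
  refine le_antisymm (ciSup_le hle) ?_
  rw [← (div_eq_iff hpos.ne').2 hτ]
  exact le_ciSup (f := fun τ : Strategy N => condProb {σ | Wins τ n σ} (noCandidateEvent N n))
    ⟨_, Set.forall_mem_range.2 hle⟩ τ

theorem optimalValueNone_nonneg (hn : n ≤ N) : 2 ≤ n → 0 ≤ optimalValueNone N n := by
  induction hn using Nat.decreasingInduction with
  | self => simp [optimalValueNone_self]
  | of_succ n hn ih =>
    intro h2
    obtain ⟨α, β, hβ, -, heq, -⟩ := exists_subgradient (a := 0) (b := 1) hn (by omega) le_rfl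
      zero_le_one (by norm_num)
    have h1 : 0 ≤ optimalValue N (n + 1) 0 1 := by linarith
    have h3 := ih (by omega)
    rw [optimalValueNone, if_pos hn]
    positivity

/-- The upper bound alone suffices for the strict inequality. It needs no nonemptiness of the event,
since an empty one gives value zero. -/
theorem valueNegOne_le_optimalValueNone (h2 : 2 ≤ n) (hn : nStar N < n) (hN : n ≤ N) :
    valueNegOne N n ≤ optimalValueNone N n := by
  refine ciSup_le fun τ => ?_
  set E : Set (Equiv.Perm (Fin N)) := {σ | ∀ i : Fin N, i.val < n → ¬ PlayerOneAccepts σ i}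
  have hE : Determined n E := fun σ σ' hs hσ i hi hp => hσ i hi ((hs.playerOneAccepts_iff hi).2 hp)
  refine div_le_of_le_mul₀ (Nat.cast_nonneg _) (optimalValueNone_nonneg hN h2) ?_
  rw [ncard_eq_sum_candidatesBefore (_ ∩ _) n, ncard_eq_sum_candidatesBefore E n, Finset.mul_sum]
  refine Finset.sum_le_sum fun h _ => ?_
  rw [Set.inter_assoc, ncard_wins_stateNone τ hN (by omega) (h := h)
    (hE.inter (determined_candidatesBefore n h)) fun σ hσ => ⟨hσ.2, hσ.1⟩]
  have := winNone_le_optimalValueNone τ h hN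
  gcongr

end WithoutCandidates

theorem theorem1 (N : ℕ) :
    ∃ v : ℕ → ℝ → ℝ,
      -- `v(n, p)` is Player 2's optimal payoff after rejecting a candidate at moment `n > n*`,
      -- where `p` is the posterior probability that this candidate has relative rank 1
      (∀ (i : Fin N) (h : Finset (Fin N)), nStar N < i.val + 1 → (historyEvent i h).Nonempty →
        historyValue i h = v (i.val + 1) (posterior i h) ∧
        ∀ p ∈ Set.Icc (0 : ℝ) 1, beliefValue i h p = v (i.val + 1) p) ∧
      (∀ n : ℕ, nStar N < n → n ≤ N → valueZero N n = v n 0) ∧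
      (∀ n : ℕ, nStar N < n → n ≤ N → MonotoneOn (v n) (Set.Icc 0 1)) ∧
      (∀ n : ℕ, nStar N < n → n < N → valueNegOne N n < v n 0) := by
  have h2 : ∀ n : ℕ, nStar N < n → n ≤ N → 2 ≤ n := fun n hn hN => by
    have := one_le_nStar (N := N) (by omega)
    omega
  refine ⟨fun n p => optimalValue N n p (1 - p), fun i h hi hne =>
    ⟨historyValue_eq_optimalValue hi hne, fun p _ => beliefValue_eq_optimalValue hi hne p⟩,
    fun n hn hN => ?_, fun n hn hN => monotoneOn_optimalValue (h2 n hn hN) hN, fun n hn hN => ?_⟩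
  · simp only [sub_zero]
    exact valueZero_eq_optimalValue hn hN
  · simp only [sub_zero]
    exact (valueNegOne_le_optimalValueNone (h2 n hn hN.le) hn hN.le).trans_lt
      ((optimalValueNone_le_and_lt hN.le (h2 n hn hN.le)).2 hN)
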